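/- Let $K$ be a field, $d\ge 1$, $S=K[t_0,\dots,t_d]$, and let $P$ be the ideal of the rational normal curve of degree $d$, i.e. the kernel of the $K$-algebra map $S\to K[x,y]$, $t_i\mapsto x^{d-i}y^i$. Let $T_d$ be the $2\times d$ matrix with first row $t_0,t_1,\dots,t_{d-1}$ and second row $t_1,t_2,\dots,t_d$. By a Cohen-Macaulay monomial initial ideal of $P$ we mean an ideal $I=\operatorname{in}_\tau(P)$, for some term order $\tau$ on $S$, such that the ring $S/I$ is Cohen-Macaulay. For a sequence $\mathbf i=(0=i_0<i_1<\dots<i_k=d)$ let $I_{\mathbf i}\subseteq S$ be the ideal generated by (i) the main diagonals $t_{v-1}t_r$ of the $2$-minors of $T_d$ with column indices $v<r$ (in $\{1,\dots,d\}$) such that $v\le i_j<r$ for some $j$, and (ii) the anti-diagonals $t_vt_{r-1}$ of the $2$-minors of $T_d$ with column indices $v<r$ such that $i_j<v<r\le i_{j+1}$ for some $j$. Theorem. (1) $P$ has exactly $2^{d-1}$ distinct Cohen-Macaulay monomial initial ideals. (2) The map $\mathbf i\mapsto I_{\mathbf i}$ is a bijection from the set of sequences $0=i_0<i_1<\dots<i_k=d$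 (of any length) onto the set of Cohen-Macaulay monomial initial ideals of $P$. These ideals are also determined by their radicals: distinct ones have distinct radicals, and $\sqrt{I_{\mathbf i}}$ is generated by the variables $t_j$ with $j\notin\{i_0,\dots,i_k\}$ and the products $t_{i_v}t_{i_w}$ with $w\ge v+2$. (3), (4) For every such sequence $\mathbf i$ there is a vector $a=(a_0,\dots,a_d)\in\mathbb N^{d+1}$ with $0=a_0<a_1<\dots<a_d$ such that the ideal $\operatorname{in}_a(P)$ of initial forms of $P$ with respect to the weight $a$ equals $I_{\mathbf i}$, there are term orders refining $a$, and for every term order $\tau$ refining $a$ one has: $\operatorname{in}_\tau(P)=I_{\mathbf i}$; the initial monomial of the $2$-minor of $T_d$ with column indices $v<r$ is $t_{v-1}t_r$ if $v\le i_j<r$ for some $j$, and $t_vt_{r-1}$ if $i_j<v<r\le i_{j+1}$ for some $j$; and $I_{\mathbf i}$ is generated by the initial monomials of the $2$-minors of $T_d$. (5) For every such sequence $\mathbf i$ and every term order $\tau$ with $\operatorname{in}_\tau(P)=I_{\mathbf i}$, the reduced Gröbner basis of $P$ with respect to $\tau$ is the set of all nonzero polynomials $$\underline{t_st_r}-t_{i_v}t_{s+r-i_v}\quad\text{with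 } 2i_v\le s+r\le i_v+i_{v+1},$$ $$\underline{t_st_r}-t_{i_{v+1}}t_{s+r-i_{v+1}}\quad\text{with } i_v+i_{v+1}\le s+r\le 2i_{v+1},$$ where $0\le s,r\le d$, $0\le v\le k-1$, and the underlined monomials are the initial monomials. -/

import Mathlib

open MvPolynomial

noncomputable section

/-! ### Cohen-Macaulay rings -/

/-- A Noetherian ring is Cohen-Macaulay if each of its localizations at a prime ideal has depth
equal to its Krull dimension, that is, the maximal ideal of the localization contains a regular
sequence whose length is the Krull dimension. -/
def IsCohenMacaulayRing (R : Type*) [CommRing R] : Prop :=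
  IsNoetherianRing R ∧
    ∀ (p : Ideal R) [p.IsPrime],
      ∃ rs : List (Localization.AtPrime p),
        (∀ x ∈ rs, x ∈ IsLocalRing.maximalIdeal (Localization.AtPrime p)) ∧
        RingTheory.Sequence.IsRegular (Localization.AtPrime p) rs ∧
        (rs.length : WithBot ℕ∞) = ringKrullDim (Localization.AtPrime p)

/-! ### Initial ideals and Gröbner bases -/

section Initial

variable {σ : Type*} {K : Type*} [Field K]

/-- The initial monomial (with coefficient `1`) of a polynomial for a term order. It is only
meaningful for nonzero polynomials. -/
def initialMonomial (m : MonomialOrder σ) (f : MvPolynomial σ K) : MvPolynomial σ K :=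
  monomial (m.degree f) 1

/-- The initial ideal of `I` for a term order. -/
def initialIdeal (m : MonomialOrder σ) (I : Ideal (MvPolynomial σ K)) :
    Ideal (MvPolynomial σ K) :=
  Ideal.span {g | ∃ f ∈ I, f ≠ 0 ∧ g = initialMonomial m f}

/-- The initial form of a polynomial for a weight vector `a`: the sum of its terms of highest
`a`-degree. -/
def weightInitialForm (a : σ → ℕ) (f : MvPolynomial σ K) : MvPolynomial σ K :=
  weightedHomogeneousComponent a (weightedTotalDegree a f) f

/-- The ideal of initial forms of `I` for a weight vector `a`. It need not be monomial. -/
def weightInitialIdeal (a : σ → ℕ) (I : Ideal (MvPolynomial σ K)) :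
    Ideal (MvPolynomial σ K) :=
  Ideal.span {g | ∃ f ∈ I, f ≠ 0 ∧ g = weightInitialForm a f}

/-- The term order `m` refines the partial order on monomials given by the weight vector `a`. -/
def RefinesWeight (m : MonomialOrder σ) (a : σ → ℕ) : Prop :=
  ∀ α β : σ →₀ ℕ, Finsupp.weight a α < Finsupp.weight a β → m.toSyn α < m.toSyn β

/-- `G` is the reduced Gröbner basis of `I` for the term order `m`. -/
structure IsReducedGroebnerBasis (m : MonomialOrder σ) (I : Ideal (MvPolynomial σ K))
    (G : Set (MvPolynomial σ K)) : Prop where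
  subset : G ⊆ I
  ne_zero : ∀ g ∈ G, g ≠ 0
  span_initial : Ideal.span (initialMonomial m '' G) = initialIdeal m I
  monic : ∀ g ∈ G, m.leadingCoeff g = 1
  reduced : ∀ g ∈ G, ∀ h ∈ G, h ≠ g → ∀ α ∈ g.support, ¬ m.degree h ≤ α

end Initial

/-! ### The rational normal curve -/

section Curve

variable (K : Type*) [Field K] (d : ℕ)

/-- The ideal of the rational normal curve of degree `d`: the kernel of
`K[t_0, …, t_d] → K[x, y]`, `t_i ↦ x ^ (d - i) * y ^ i`. -/
def rationalNormalCurveIdeal : Ideal (MvPolynomial (Fin (d + 1)) K) :=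
  RingHom.ker (aeval (R := K) fun i : Fin (d + 1) =>
    (X 0 ^ (d - (i : ℕ)) * X 1 ^ (i : ℕ) : MvPolynomial (Fin 2) K))

/-- The `2 × d` matrix with rows `t_0, …, t_{d-1}` and `t_1, …, t_d`. -/
def curveMatrix : Matrix (Fin 2) (Fin d) (MvPolynomial (Fin (d + 1)) K) :=
  Matrix.of ![fun c => X c.castSucc, fun c => X c.succ]

/-- The `2`-minor of `curveMatrix` on the columns `c` and `e` (numbered from `0`), that is,
`t_c t_{e+1} - t_e t_{c+1}`. -/
def curveMinor (c e : Fin d) : MvPolynomial (Fin (d + 1)) K :=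
  ((curveMatrix K d).submatrix id ![c, e]).det

/-- The set of Cohen-Macaulay monomial initial ideals of the ideal of the rational normal curve:
the initial ideals for term orders whose quotient ring is Cohen-Macaulay. -/
def cmInitialIdeals : Set (Ideal (MvPolynomial (Fin (d + 1)) K)) :=
  {I | (∃ m : MonomialOrder.{0, 0} (Fin (d + 1)),
          I = initialIdeal m (rationalNormalCurveIdeal K d)) ∧
        IsCohenMacaulayRing (MvPolynomial (Fin (d + 1)) K ⧸ I)}

end Curve

/-- The sequences `0 = i_0 < i_1 < ⋯ < i_k = d`, of any length. -/
structure BreakSeq (d : ℕ) where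
  k : ℕ
  i : Fin (k + 1) → Fin (d + 1)
  strictMono : StrictMono i
  first : i 0 = 0
  last : i (Fin.last k) = Fin.last d

namespace BreakSeq

variable (K : Type*) [Field K] {d : ℕ} (s : BreakSeq d)

/-- The columns `c < e` (numbered from `0`) lie in different blocks of the matrix, the blocks being
formed by the columns numbered `i_j, …, i_{j+1} - 1`. -/
def Separates (c e : Fin d) : Prop :=
  ∃ j : Fin (s.k + 1), (c : ℕ) < s.i j ∧ (s.i j : ℕ) ≤ e

/-- The columns `c < e` (numbered from `0`) lie in the same block of the matrix. -/
def SameBlock (c e : Fin d) : Prop :=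
  ∃ j : Fin s.k, (s.i j.castSucc : ℕ) ≤ c ∧ (e : ℕ) < s.i j.succ

/-- The monomial ideal generated by the main diagonals of the `2`-minors with columns in different
blocks and the anti-diagonals of the `2`-minors with columns in the same block. -/
def ideal : Ideal (MvPolynomial (Fin (d + 1)) K) :=
  Ideal.span
    ({g | ∃ c e : Fin d, c < e ∧ s.Separates c e ∧ g = X c.castSucc * X e.succ} ∪
     {g | ∃ c e : Fin d, c < e ∧ s.SameBlock c e ∧ g = X c.succ * X e.castSucc})

/-- The ideal generated by the variables `t_j` with `j` not in the sequence and the products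
`t_{i_v} t_{i_w}` with `w ≥ v + 2`. -/
def radicalIdeal : Ideal (MvPolynomial (Fin (d + 1)) K) :=
  Ideal.span
    ({g | ∃ j : Fin (d + 1), j ∉ Set.range s.i ∧ g = X j} ∪
     {g | ∃ v w : Fin (s.k + 1), (v : ℕ) + 2 ≤ w ∧ g = X (s.i v) * X (s.i w)})

/-- The four indices of a binomial `t_a t_b - t_p t_q` of the reduced Gröbner basis: one has
`q = a + b - p`, where `p = i_v` if `2 i_v ≤ a + b ≤ i_v + i_{v+1}` and `p = i_{v+1}` if
`i_v + i_{v+1} ≤ a + b ≤ 2 i_{v+1}`. The case where the binomial is zero is left out. -/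
def IsRule (a b p q : Fin (d + 1)) : Prop :=
  (p : ℕ) + q = a + b ∧
  a ≠ p ∧ a ≠ q ∧
  ∃ v : Fin s.k,
    (p = s.i v.castSucc ∧ 2 * (s.i v.castSucc : ℕ) ≤ a + b ∧
      (a : ℕ) + b ≤ s.i v.castSucc + s.i v.succ) ∨
    (p = s.i v.succ ∧ (s.i v.castSucc : ℕ) + s.i v.succ ≤ a + b ∧
      (a : ℕ) + b ≤ 2 * s.i v.succ)

/-- The binomials `t_a t_b - t_p t_q` for all indices as in `IsRule`. -/
def binomials : Set (MvPolynomial (Fin (d + 1)) K) :=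
  {g | ∃ a b p q : Fin (d + 1), s.IsRule a b p q ∧ g = X a * X b - X p * X q}

end BreakSeq

end

/-!
The map to `K[x, y]` is monomial, so it sorts the monomials of `S` into fibres; two monomials lie in
the same fibre if they have the same degree and the same sum of indices (`curveExponent_eq_iff`). An
initial ideal of `P` consists of the monomials that are not least in their fibre, so exactly one
monomial of each fibre is standard, that is, outside the initial ideal.

A sequence is encoded by the set `V` of its members, the vertices; two consecutive vertices form an
edge. The ideal of the sequence is `vertexIdeal K V`, generated by the quadrics `t_a t_b` that are
forbidden: a vertex lies strictly between `a` and `b`, or neither of them is a vertex. Each fibre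
contains at most one monomial outside this ideal (`eq_of_not_hasForbidden`): the monomials outside
are `t_p ^ m t_q ^ n t_c` with `(p, q)` an edge and `p ≤ c ≤ q`. So an initial ideal that contains
`vertexIdeal K V` equals it (`initialIdeal_curve_eq_vertexIdeal`). The weight `vertexWeight V`
selects the prescribed term of each `2`-minor, as its jumps grow exactly at the vertices; this gives
the statements on weights. The reduced Gröbner basis rewrites each forbidden quadric into the
allowed quadric of its fibre, and the radical is the intersection of the ideals of the coordinate
planes of the edges.

The quotient by `vertexIdeal K V` is Cohen-Macaulay. Take as parameters the sum of the vertices at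
even positions of the sequence and the sum of those at odd positions; on the coordinate plane of an
edge they restrict to the two coordinates. Over the polynomial ring in these parameters the
quotient is spanned by `1` and all `t_j` but `t_0` and `t_{i_1}` (`BreakSeq.span_gen`), and these
elements are independent, as is seen on the coordinate planes and their first order neighbourhoods
(`BreakSeq.linearIndependent_gen`). An integral flat extension of a polynomial ring in two variables
is Cohen-Macaulay (`isCohenMacaulayRing_of_flat_of_isIntegral`).

Conversely, let the quotient by an initial ideal be Cohen-Macaulay, and let `V` be the set of the
indices `j` such that all powers of `t_j` are standard. The minimal primes of the initial ideal are
the ideals of the coordinate planes of the edges of `V`. There are no embedded primes, so each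
standard monomial stays standard under multiplication by powers of `t_p` and `t_q` for some edge
`(p, q)` (`isUnmixed_of_isCohenMacaulayRing`). In particular each index that is not a vertex can be
assigned to such an edge. For a fixed edge, such a monomial is determined, up to its exponents at
`p` and `q`, by its sum of indices, counted from `p`, modulo `q - p`, because high powers of `t_p`
and `t_q` bring two monomials with the same residue into the same fibre. Hence at most `q - p - 1`
indices are assigned to `(p, q)`; as these numbers add up to the number of all indices that are not
vertices, equality holds, and all residues occur. It follows that a standard quadric has an end of
an edge as one factor, and an end of the same edge or an index assigned to it as the other. By
induction from left to right, the indices assigned to `(p, q)` are those in between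
(`IsStandardSet.assigned_eq_Ioo`). So all forbidden quadrics of `V` lie in the initial ideal, which
is therefore `vertexIdeal K V`. The set `V` can be recovered from the radical, and there are
`2 ^ (d - 1)` sets of indices that contain `0` and `d`.
-/

/-! ### Monomial ideals -/

section MonomialIdeals

variable {σ K : Type*} [Field K]

theorem single_add_single_eq_X_mul_X (a b : σ) :
    (monomial (Finsupp.single a 1 + Finsupp.single b 1) 1 : MvPolynomial σ K) = X a * X b := by
  rw [X, X, monomial_mul, one_mul]

theorem initialIdeal_eq_span_image (m : MonomialOrder σ) (I : Ideal (MvPolynomial σ K)) :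
    initialIdeal m I =
      Ideal.span ((fun u => monomial u (1 : K)) '' {u | ∃ f ∈ I, f ≠ 0 ∧ u = m.degree f}) := by
  unfold initialIdeal
  congr 1
  ext g
  constructor
  · rintro ⟨f, hf, h0, rfl⟩
    exact ⟨_, ⟨f, hf, h0, rfl⟩, rfl⟩
  · rintro ⟨_, ⟨f, hf, h0, rfl⟩, rfl⟩
    exact ⟨f, hf, h0, rfl⟩

theorem monomial_mem_span_iff {S : Set (σ →₀ ℕ)} {u : σ →₀ ℕ} :
    monomial u (1 : K) ∈ Ideal.span ((fun u => monomial u (1 : K)) '' S) ↔ ∃ s ∈ S, s ≤ u := by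
  classical
  rw [mem_ideal_span_monomial_image]
  simp [coeff_monomial]

/-- The leading exponent of a difference of two monomials. -/
theorem degree_monomial_sub_monomial (m : MonomialOrder σ) {u v : σ →₀ ℕ}
    (h : m.toSyn v < m.toSyn u) :
    m.degree (monomial u (1 : K) - monomial v 1) = u := by
  classical
  rw [sub_eq_add_neg, ← map_neg, m.degree_add_of_lt]
  · simp [m.degree_monomial]
  · simpa [m.degree_monomial] using h

theorem monomial_sub_monomial_ne_zero {u v : σ →₀ ℕ} (h : u ≠ v) :
    monomial u (1 : K) - monomial v 1 ≠ 0 := by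
  intro h0
  exact h (monomial_left_injective one_ne_zero (sub_eq_zero.1 h0))

theorem isPrime_span_X_image (s : Set σ) :
    (Ideal.span (X '' s : Set (MvPolynomial σ K))).IsPrime := by
  classical
  -- the ideal is the kernel of the map setting the variables of `s` to zero
  let φ : MvPolynomial σ K →ₐ[K] MvPolynomial σ K := aeval fun j => if j ∈ s then 0 else X j
  have hφ : (Ideal.Quotient.mkₐ K (Ideal.span (X '' s : Set (MvPolynomial σ K)))).comp φ =
      Ideal.Quotient.mkₐ K _ := by
    refine algHom_ext fun j => ?_
    simp only [AlgHom.comp_apply, φ, aeval_X]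
    split_ifs with h
    · rw [map_zero]
      symm
      exact Ideal.Quotient.eq_zero_iff_mem.2 (Ideal.subset_span (Set.mem_image_of_mem X h))
    · rfl
  have hker : Ideal.span (X '' s : Set (MvPolynomial σ K)) = RingHom.ker φ := by
    refine le_antisymm (Ideal.span_le.2 ?_) fun f hf => ?_
    · rintro _ ⟨j, hj, rfl⟩
      simp [φ, RingHom.mem_ker, hj]
    · have h := DFunLike.congr_fun hφ f
      rw [AlgHom.comp_apply, RingHom.mem_ker.1 hf, map_zero] at h
      exact Ideal.Quotient.eq_zero_iff_mem.1 h.symm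
  rw [hker]
  exact RingHom.ker_isPrime _

end MonomialIdeals

/-! ### The bigrading of the rational normal curve -/

section Bigrading

variable {d : ℕ}

/-- The exponent of the image of the monomial `t ^ u` in `K[x, y]`. Two monomials lie in the same
fibre if these exponents agree. -/
noncomputable def curveExponent (d : ℕ) : (Fin (d + 1) →₀ ℕ) →+ (Fin 2 →₀ ℕ) :=
  Finsupp.weight fun i : Fin (d + 1) =>
    Finsupp.single (0 : Fin 2) (d - (i : ℕ)) + Finsupp.single 1 (i : ℕ)

/-- The sum of the indices of the variables of a monomial, with multiplicity. -/
noncomputable def indexSum (d : ℕ) : (Fin (d + 1) →₀ ℕ) →+ ℕ :=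
  Finsupp.weight fun i : Fin (d + 1) => (i : ℕ)

@[simp] theorem indexSum_single (i : Fin (d + 1)) (n : ℕ) :
    indexSum d (Finsupp.single i n) = n * i := by
  simp [indexSum, Finsupp.weight_single]

theorem curveExponent_one (u : Fin (d + 1) →₀ ℕ) : curveExponent d u 1 = indexSum d u := by
  induction u using Finsupp.induction_linear with
  | zero => simp
  | add u v hu hv => simp [hu, hv]
  | single i n => simp [curveExponent, Finsupp.weight_single]

theorem curveExponent_zero_add (u : Fin (d + 1) →₀ ℕ) :
    curveExponent d u 0 + indexSum d u = d * u.degree := by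
  induction u using Finsupp.induction_linear with
  | zero => simp
  | add u v hu hv => simp only [map_add, Finsupp.add_apply, mul_add]; omega
  | single i n =>
    have := i.is_le
    obtain ⟨e, he⟩ := Nat.exists_eq_add_of_le this
    simp [curveExponent, Finsupp.weight_single, he]
    ring

/-- Two monomials lie in the same fibre if and only if they have the same degree and the same sum
of indices. -/
theorem curveExponent_eq_iff (hd : 1 ≤ d) {u v : Fin (d + 1) →₀ ℕ} :
    curveExponent d u = curveExponent d v ↔
      u.degree = v.degree ∧ indexSum d u = indexSum d v := by
  have hu := curveExponent_zero_add u
  have hv := curveExponent_zero_add v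
  constructor
  · intro h
    have h1 : indexSum d u = indexSum d v := by
      rw [← curveExponent_one, ← curveExponent_one, h]
    refine ⟨Nat.eq_of_mul_eq_mul_left hd ?_, h1⟩
    rw [← hu, ← hv, h, h1]
  · rintro ⟨h1, h2⟩
    ext i
    fin_cases i
    · rw [h1] at hu
      simp only [Fin.zero_eta]
      omega
    · simpa [curveExponent_one] using h2

variable {K : Type*} [Field K]

theorem aeval_curve_monomial (u : Fin (d + 1) →₀ ℕ) (c : K) :
    aeval (R := K) (fun i : Fin (d + 1) =>
      (X 0 ^ (d - (i : ℕ)) * X 1 ^ (i : ℕ) : MvPolynomial (Fin 2) K)) (monomial u c) =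
      monomial (curveExponent d u) c := by
  rw [aeval_monomial, algebraMap_eq, curveExponent, Finsupp.weight_apply, Finsupp.sum,
    ← mul_one c, ← C_mul_monomial, monomial_sum_one, mul_one, Finsupp.prod]
  congr 1
  refine Finset.prod_congr rfl fun i _ => ?_
  rw [X_pow_eq_monomial, X_pow_eq_monomial, monomial_mul, monomial_pow]
  simp

theorem monomial_sub_monomial_mem_curveIdeal {u v : Fin (d + 1) →₀ ℕ}
    (h : curveExponent d u = curveExponent d v) :
    monomial u (1 : K) - monomial v 1 ∈ rationalNormalCurveIdeal K d := by
  rw [rationalNormalCurveIdeal, RingHom.mem_ker, map_sub]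
  have hu := aeval_curve_monomial u (1 : K)
  have hv := aeval_curve_monomial v (1 : K)
  rw [h] at hu
  exact sub_eq_zero.2 (hu.trans hv.symm)

/-- A polynomial of the curve ideal has no fibre with exactly one term. -/
theorem exists_ne_mem_support_of_mem_curveIdeal {f : MvPolynomial (Fin (d + 1)) K}
    (hf : f ∈ rationalNormalCurveIdeal K d) {u : Fin (d + 1) →₀ ℕ} (hu : u ∈ f.support) :
    ∃ v ∈ f.support, v ≠ u ∧ curveExponent d v = curveExponent d u := by
  classical
  by_contra! hne
  rw [rationalNormalCurveIdeal, RingHom.mem_ker] at hf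
  have h : coeff (curveExponent d u) (aeval (R := K) (fun i : Fin (d + 1) =>
      (X 0 ^ (d - (i : ℕ)) * X 1 ^ (i : ℕ) : MvPolynomial (Fin 2) K)) f) = coeff u f := by
    conv_lhs => rw [f.as_sum, map_sum, coeff_sum]
    rw [Finset.sum_eq_single u]
    · rw [aeval_curve_monomial, coeff_monomial, if_pos rfl]
    · intro v hv hvu
      rw [aeval_curve_monomial, coeff_monomial, if_neg (hne v hv hvu)]
    · intro h
      exact absurd hu h
  have h0 : coeff u f = 0 := by
    rw [← h]
    exact congrArg (coeff (curveExponent d u)) hf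
  exact (mem_support_iff.1 hu) h0

/-- The monomials of the initial ideal of the curve ideal are those that are not least in their
fibre. -/
theorem exists_le_degree_iff (m : MonomialOrder (Fin (d + 1))) (u : Fin (d + 1) →₀ ℕ) :
    (∃ s ∈ {s | ∃ f ∈ rationalNormalCurveIdeal K d, f ≠ 0 ∧ s = m.degree f}, s ≤ u) ↔
      ∃ v, curveExponent d v = curveExponent d u ∧ m.toSyn v < m.toSyn u := by
  constructor
  · rintro ⟨_, ⟨f, hf, h0, rfl⟩, hle⟩
    obtain ⟨v, hv, hne, hvd⟩ :=
      exists_ne_mem_support_of_mem_curveIdeal hf (m.degree_mem_support h0)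
    have hlt : m.toSyn v < m.toSyn (m.degree f) :=
      lt_of_le_of_ne (m.le_degree hv) fun h => hne (m.toSyn.injective h)
    obtain ⟨w, rfl⟩ := exists_add_of_le hle
    exact ⟨v + w, by simp [hvd], by simpa using hlt⟩
  · rintro ⟨v, hvu, hlt⟩
    refine ⟨u, ⟨_, monomial_sub_monomial_mem_curveIdeal (K := K) hvu.symm,
      monomial_sub_monomial_ne_zero ?_, (degree_monomial_sub_monomial m hlt).symm⟩, le_rfl⟩
    rintro rfl
    exact lt_irrefl _ hlt

theorem mem_initialIdeal_curve_iff (m : MonomialOrder (Fin (d + 1)))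
    (f : MvPolynomial (Fin (d + 1)) K) :
    f ∈ initialIdeal m (rationalNormalCurveIdeal K d) ↔ ∀ u ∈ f.support,
      ∃ v, curveExponent d v = curveExponent d u ∧ m.toSyn v < m.toSyn u := by
  rw [initialIdeal_eq_span_image, mem_ideal_span_monomial_image]
  exact forall₂_congr fun u _ => exists_le_degree_iff m u

theorem monomial_mem_initialIdeal_curve_iff (m : MonomialOrder (Fin (d + 1)))
    (u : Fin (d + 1) →₀ ℕ) :
    monomial u (1 : K) ∈ initialIdeal m (rationalNormalCurveIdeal K d) ↔
      ∃ v, curveExponent d v = curveExponent d u ∧ m.toSyn v < m.toSyn u := by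
  rw [initialIdeal_eq_span_image, monomial_mem_span_iff, exists_le_degree_iff m u]

/-- Every fibre contains a monomial outside the initial ideal, namely its least element. -/
theorem exists_monomial_notMem_initialIdeal_curve (m : MonomialOrder (Fin (d + 1)))
    (u : Fin (d + 1) →₀ ℕ) :
    ∃ v, curveExponent d v = curveExponent d u ∧
      monomial v (1 : K) ∉ initialIdeal m (rationalNormalCurveIdeal K d) := by
  obtain ⟨v, hv, hmin⟩ := (InvImage.wf m.toSyn (wellFounded_lt (α := m.syn))).has_min
    {v | curveExponent d v = curveExponent d u} ⟨u, rfl⟩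
  refine ⟨v, hv, ?_⟩
  rw [monomial_mem_initialIdeal_curve_iff]
  rintro ⟨w, hw, hlt⟩
  exact hmin w (hw.trans hv) hlt

/-- A fibre contains at most one monomial outside the initial ideal. -/
theorem eq_of_notMem_initialIdeal_curve (m : MonomialOrder (Fin (d + 1)))
    {u v : Fin (d + 1) →₀ ℕ} (h : curveExponent d u = curveExponent d v)
    (hu : monomial u (1 : K) ∉ initialIdeal m (rationalNormalCurveIdeal K d))
    (hv : monomial v (1 : K) ∉ initialIdeal m (rationalNormalCurveIdeal K d)) : u = v := by
  rw [monomial_mem_initialIdeal_curve_iff] at hu hv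
  refine m.toSyn.injective (le_antisymm ?_ ?_)
  · by_contra! hlt
    exact hu ⟨v, h.symm, hlt⟩
  · by_contra! hlt
    exact hv ⟨u, h, hlt⟩

end Bigrading

/-! ### The monomial ideal of a set of vertices -/

section Vertices

variable {d : ℕ}

/-- The quadrics `t_a t_b` of the ideal attached to a set `V` of vertices: either a vertex lies
strictly between `a` and `b`, or neither `a` nor `b` is a vertex. -/
def IsForbidden (V : Set (Fin (d + 1))) (a b : Fin (d + 1)) : Prop :=
  (∃ i ∈ V, a < i ∧ i < b) ∨ (∃ i ∈ V, b < i ∧ i < a) ∨ (a ∉ V ∧ b ∉ V)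

/-- The exponents of the monomials divisible by a quadric as in `IsForbidden`. -/
def HasForbidden (V : Set (Fin (d + 1))) (u : Fin (d + 1) →₀ ℕ) : Prop :=
  ∃ a b, IsForbidden V a b ∧ Finsupp.single a 1 + Finsupp.single b 1 ≤ u

/-- `p < q` are vertices with no vertex in between. -/
structure IsEdge (V : Set (Fin (d + 1))) (p q : Fin (d + 1)) : Prop where
  left : p ∈ V
  right : q ∈ V
  lt : p < q
  le_or_le : ∀ r ∈ V, r ≤ p ∨ q ≤ r

variable {V : Set (Fin (d + 1))}

theorem IsForbidden.symm {a b : Fin (d + 1)} (h : IsForbidden V a b) : IsForbidden V b a := by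
  rcases h with h | h | h
  · exact Or.inr (Or.inl h)
  · exact Or.inl h
  · exact Or.inr (Or.inr h.symm)

theorem IsForbidden.hasForbidden {a b : Fin (d + 1)} (h : IsForbidden V a b)
    {u : Fin (d + 1) →₀ ℕ} (hab : a ≠ b) (ha : u a ≠ 0) (hb : u b ≠ 0) : HasForbidden V u := by
  classical
  refine ⟨a, b, h, fun j => ?_⟩
  simp only [Finsupp.add_apply, Finsupp.single_apply]
  split_ifs with h1 h2 h2
  · exact absurd (h1.trans h2.symm) hab
  · subst h1; omega
  · subst h2; omega
  · omega

theorem le_one_of_not_hasForbidden {u : Fin (d + 1) →₀ ℕ} (h : ¬ HasForbidden V u)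
    {c : Fin (d + 1)} (hc : c ∉ V) : u c ≤ 1 := by
  by_contra! h1
  refine h ⟨c, c, Or.inr (Or.inr ⟨hc, hc⟩), ?_⟩
  rw [← Finsupp.single_add, Finsupp.single_le_iff]
  omega

namespace IsEdge

theorem eq_right {p q q' : Fin (d + 1)} (h : IsEdge V p q) (h' : IsEdge V p q') : q = q' := by
  have h1 := h.le_or_le q' h'.right
  have h2 := h'.le_or_le q h.right
  have h3 := h.lt
  have h4 := h'.lt
  omega

theorem right_le_left {p q p' q' : Fin (d + 1)} (h : IsEdge V p q) (h' : IsEdge V p' q')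
    (hlt : p < p') : q ≤ p' := by
  have h1 := h.le_or_le p' h'.left
  omega

theorem notMem {p q c : Fin (d + 1)} (h : IsEdge V p q) (h1 : p < c) (h2 : c < q) : c ∉ V := by
  intro hc
  have := h.le_or_le c hc
  omega

end IsEdge

theorem exists_isEdge_le_lt (h0 : 0 ∈ V) (hl : Fin.last d ∈ V) {j : Fin (d + 1)}
    (hj : j < Fin.last d) : ∃ p q, IsEdge V p q ∧ p ≤ j ∧ j < q := by
  obtain ⟨p, ⟨hpV, hpj⟩, hp⟩ := Set.exists_max_image {p | p ∈ V ∧ p ≤ j} id (Set.toFinite _)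
    ⟨0, h0, Fin.zero_le _⟩
  obtain ⟨q, ⟨hqV, hqj⟩, hq⟩ := Set.exists_min_image {q | q ∈ V ∧ j < q} id (Set.toFinite _)
    ⟨_, hl, hj⟩
  refine ⟨p, q, ⟨hpV, hqV, hpj.trans_lt hqj, fun r hr => ?_⟩, hpj, hqj⟩
  rcases le_or_gt r j with h | h
  · exact Or.inl (hp r ⟨hr, h⟩)
  · exact Or.inr (hq r ⟨hr, h⟩)

theorem exists_isEdge_lt_le (h0 : 0 ∈ V) (hl : Fin.last d ∈ V) {j : Fin (d + 1)}
    (hj : 0 < j) : ∃ p q, IsEdge V p q ∧ p < j ∧ j ≤ q := by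
  obtain ⟨p, ⟨hpV, hpj⟩, hp⟩ := Set.exists_max_image {p | p ∈ V ∧ p < j} id (Set.toFinite _)
    ⟨0, h0, hj⟩
  obtain ⟨q, ⟨hqV, hqj⟩, hq⟩ := Set.exists_min_image {q | q ∈ V ∧ j ≤ q} id (Set.toFinite _)
    ⟨_, hl, Fin.le_last _⟩
  refine ⟨p, q, ⟨hpV, hqV, hpj.trans_le hqj, fun r hr => ?_⟩, hpj, hqj⟩
  rcases lt_or_ge r j with h | h
  · exact Or.inl (hp r ⟨hr, h⟩)
  · exact Or.inr (hq r ⟨hr, h⟩)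

/-- Two indices are not a forbidden pair exactly if one is an end of an edge containing both. -/
theorem not_isForbidden_iff (hd : 1 ≤ d) (h0 : 0 ∈ V) (hl : Fin.last d ∈ V) {a b : Fin (d + 1)} :
    ¬ IsForbidden V a b ↔ ∃ p q, IsEdge V p q ∧ p ≤ a ∧ a ≤ q ∧ p ≤ b ∧ b ≤ q ∧
      (a = p ∨ a = q ∨ b = p ∨ b = q) := by
  constructor
  · intro h
    wlog hab : a ≤ b generalizing a b
    · obtain ⟨p, q, h1, h2, h3, h4, h5, h6⟩ := this (fun h' => h h'.symm) (le_of_not_ge hab)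
      exact ⟨p, q, h1, h4, h5, h2, h3, by tauto⟩
    simp only [IsForbidden, not_or, not_exists, not_and, not_not] at h
    obtain ⟨h1, -, h3⟩ := h
    by_cases haV : a ∈ V
    · by_cases hal : a = Fin.last d
      · subst hal
        obtain rfl : b = Fin.last d := le_antisymm (Fin.le_last _) hab
        obtain ⟨p, q, he, hp, hq⟩ := exists_isEdge_lt_le h0 hl
          (j := Fin.last d) (Fin.lt_def.2 (by simp; omega))
        exact ⟨p, q, he, hp.le, hq, hp.le, hq,
          Or.inr (Or.inl (le_antisymm hq (Fin.le_last _)))⟩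
      · obtain ⟨p, q, he, hp, hq⟩ := exists_isEdge_le_lt h0 hl
          (lt_of_le_of_ne (Fin.le_last a) hal)
        have hpa : a = p := by
          have := he.le_or_le a haV
          omega
        refine ⟨p, q, he, hp, hq.le, hp.trans hab, ?_, Or.inl hpa⟩
        have := h1 q he.right hq
        omega
    · have hbV := h3 haV
      have ha0 : 0 < a := by
        rw [Fin.pos_iff_ne_zero]; rintro rfl; exact haV h0
      obtain ⟨p, q, he, hp, hq⟩ := exists_isEdge_lt_le h0 hl (ha0.trans_le hab)
      have hqb : b = q := by
        have := he.le_or_le b hbV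
        omega
      refine ⟨p, q, he, ?_, hab.trans hq, hp.le, hq, by tauto⟩
      by_contra! hap
      exact h1 p he.left hap hp
  · rintro ⟨p, q, he, h1, h2, h3, h4, h5⟩ (⟨i, hi, h6, h7⟩ | ⟨i, hi, h6, h7⟩ | ⟨h6, h7⟩)
    · have := he.le_or_le i hi
      omega
    · have := he.le_or_le i hi
      omega
    · rcases h5 with rfl | rfl | rfl | rfl
      · exact h6 he.left
      · exact h6 he.right
      · exact h7 he.left
      · exact h7 he.right

/-- A monomial outside the ideal of `V` is supported on an edge, and at most one of its factors
is not a vertex. -/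
theorem exists_eq_of_not_hasForbidden (hd : 1 ≤ d) (h0 : 0 ∈ V) (hl : Fin.last d ∈ V)
    {u : Fin (d + 1) →₀ ℕ} (h : ¬ HasForbidden V u) (hu : u ≠ 0) :
    ∃ p q c m n, IsEdge V p q ∧ p ≤ c ∧ c ≤ q ∧
      u = Finsupp.single p m + Finsupp.single q n + Finsupp.single c 1 := by
  classical
  -- `c` is chosen as a factor that is not a vertex if there is one, and as the least factor if not
  obtain ⟨c, hc0, hc⟩ : ∃ c, u c ≠ 0 ∧ ((c ∉ V) ∨ ∀ j, u j ≠ 0 → j ∈ V ∧ c ≤ j) := by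
    by_cases hV : ∃ c, u c ≠ 0 ∧ c ∉ V
    · obtain ⟨c, h1, h2⟩ := hV
      exact ⟨c, h1, Or.inl h2⟩
    · push Not at hV
      obtain ⟨c, hc, hmin⟩ := Finset.exists_min_image u.support id
        (Finsupp.support_nonempty_iff.2 hu)
      refine ⟨c, Finsupp.mem_support_iff.1 hc, Or.inr fun j hj => ⟨hV j hj, ?_⟩⟩
      exact hmin j (Finsupp.mem_support_iff.2 hj)
  have key : ∀ j, u j ≠ 0 → j ≠ c → ¬ IsForbidden V c j := fun j hj hne hf =>
    h (hf.hasForbidden hne.symm hc0 hj)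
  obtain ⟨p, q, he, hp, hq, hj⟩ : ∃ p q, IsEdge V p q ∧ p ≤ c ∧ c ≤ q ∧
      ∀ j, u j ≠ 0 → j ≠ c → j = p ∨ j = q := by
    by_cases hcl : c = Fin.last d
    · obtain ⟨p, q, he, hp, hq⟩ := exists_isEdge_lt_le h0 hl
        (j := c) (by rw [hcl]; exact Fin.lt_def.2 (by simp; omega))
      refine ⟨p, q, he, hp.le, hq, fun j hj hne => ?_⟩
      rcases hc with hc | hc
      · exact absurd (hcl ▸ hl) hc
      · exact absurd (le_antisymm (hcl ▸ Fin.le_last j) (hc j hj).2) hne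
    · obtain ⟨p, q, he, hp, hq⟩ := exists_isEdge_le_lt h0 hl
        (lt_of_le_of_ne (Fin.le_last c) hcl)
      refine ⟨p, q, he, hp, hq.le, fun j hj hne => ?_⟩
      have hk := key j hj hne
      simp only [IsForbidden, not_or, not_exists, not_and, not_not] at hk
      have h1 := hk.1 q he.right hq
      have hjV : j ∈ V := by
        rcases hc with hc | hc
        · exact hk.2.2 hc
        · exact (hc j hj).1
      have h2 := he.le_or_le j hjV
      have h3 : p ≤ j := by
        rcases hc with hc | hc
        · have hpc : p < c := lt_of_le_of_ne hp (by rintro rfl; exact hc he.left)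
          by_contra! hlt
          exact hk.2.1 p he.left hlt hpc
        · exact hp.trans (hc j hj).2
      omega
  have hpq := he.lt.ne
  refine ⟨p, q, c, if p = c then u p - 1 else u p, if q = c then u q - 1 else u q, he, hp, hq, ?_⟩
  ext j
  simp only [Finsupp.add_apply, Finsupp.single_apply]
  by_cases hjc : j = c
  · subst hjc
    by_cases hp' : p = j
    · subst hp'
      simp [hpq.symm]
      omega
    · by_cases hq' : q = j
      · subst hq'
        simp [hpq]
        omega
      · have hjV : j ∉ V := he.notMem (lt_of_le_of_ne hp hp') (lt_of_le_of_ne hq (Ne.symm hq'))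
        have := le_one_of_not_hasForbidden h hjV
        simp [hp', hq']
        omega
  · by_cases hu0 : u j = 0
    · have : ∀ k, k = j → u k = 0 := by rintro _ rfl; exact hu0
      rw [hu0]
      split_ifs <;> simp_all
    · rcases hj j hu0 hjc with rfl | rfl
      · simp [hjc, hpq.symm, Ne.symm hjc]
      · simp [hjc, hpq, Ne.symm hjc]

/-- A fibre contains at most one monomial outside the ideal of `V`. -/
theorem eq_of_not_hasForbidden (hd : 1 ≤ d) (h0 : 0 ∈ V) (hl : Fin.last d ∈ V)
    {u v : Fin (d + 1) →₀ ℕ} (huv : curveExponent d u = curveExponent d v)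
    (hu : ¬ HasForbidden V u) (hv : ¬ HasForbidden V v) : u = v := by
  obtain ⟨hdeg, hsum⟩ := (curveExponent_eq_iff hd).1 huv
  by_cases hu0 : u = 0
  · subst hu0
    rw [map_zero] at hdeg
    exact ((Finsupp.degree_eq_zero_iff v).1 hdeg.symm).symm
  have hv0 : v ≠ 0 := by
    rintro rfl
    rw [map_zero] at hdeg
    exact hu0 ((Finsupp.degree_eq_zero_iff u).1 hdeg)
  obtain ⟨p, q, c, m, n, he, hpc, hcq, rfl⟩ := exists_eq_of_not_hasForbidden hd h0 hl hu hu0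
  obtain ⟨p', q', c', m', n', he', hpc', hcq', rfl⟩ :=
    exists_eq_of_not_hasForbidden hd h0 hl hv hv0
  clear hu hv hu0 hv0 huv
  wlog hpp : p ≤ p' generalizing p q c m n p' q' c' m' n'
  · exact (this _ _ _ _ _ he' hpc' hcq' _ _ _ _ _ he hpc hcq hdeg.symm hsum.symm
      (le_of_not_ge hpp)).symm
  simp only [map_add, Finsupp.degree_single, indexSum_single, one_mul] at hdeg hsum
  rw [Fin.le_def] at hpc hcq hpc' hcq'
  have hlt := Fin.lt_def.1 he.lt
  have hlt' := Fin.lt_def.1 he'.lt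
  rcases hpp.lt_or_eq with hpp | rfl
  · -- the sums of indices can only agree if both monomials are powers of the common end
    have hqp := Fin.le_def.1 (he.right_le_left he' hpp)
    obtain ⟨x, hx⟩ := Nat.exists_eq_add_of_lt hlt
    obtain ⟨x', hx'⟩ := Nat.exists_eq_add_of_lt hlt'
    obtain ⟨y, hy⟩ := Nat.exists_eq_add_of_le hqp
    obtain ⟨z, hz⟩ := Nat.exists_eq_add_of_le hcq
    obtain ⟨z', hz'⟩ := Nat.exists_eq_add_of_le hpc'
    have e1 : (m + n + 1) * (q : ℕ) = m * p + n * q + c + m * (x + 1) + z := by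
      rw [hx] at hz ⊢; rw [add_mul, add_mul]
      nlinarith
    have e2 : m' * (p' : ℕ) + n' * q' + c' = (m + n + 1) * p' + n' * (x' + 1) + z' := by
      rw [hdeg, hx', hz']; ring
    have e3 : (m + n + 1) * (p' : ℕ) = (m + n + 1) * q + (m + n + 1) * y := by rw [hy]; ring
    have e4 : m * (x + 1) + z + n' * (x' + 1) + z' + (m + n + 1) * y = 0 := by omega
    simp only [add_eq_zero, mul_eq_zero, or_false, false_or, and_false, one_ne_zero] at e4
    obtain ⟨⟨⟨⟨hm, hz0⟩, hn'⟩, hz0'⟩, hy0⟩ := e4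
    have hc : c = q := Fin.ext (by omega)
    have hc' : c' = p' := Fin.ext (by omega)
    have hq : q = p' := Fin.ext (by omega)
    subst hc hc' hq hm hn'
    obtain rfl : n = m' := by omega
    simp
  · obtain rfl := he.eq_right he'
    obtain ⟨x, hx⟩ := Nat.exists_eq_add_of_lt hlt
    obtain ⟨y, hy⟩ := Nat.exists_eq_add_of_le hpc
    obtain ⟨y', hy'⟩ := Nat.exists_eq_add_of_le hpc'
    have e : n * (x + 1) + y = n' * (x + 1) + y' := by
      rw [hx, hy, hy'] at hsum
      have e1 : m * (p : ℕ) + n * (p + x + 1) + (p + y) =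
        (m + n + 1) * p + (n * (x + 1) + y) := by ring
      have e2 : m' * (p : ℕ) + n' * (p + x + 1) + (p + y') =
        (m + n + 1) * p + (n' * (x + 1) + y') := by rw [hdeg]; ring
      omega
    have hyx : y ≤ x + 1 := by omega
    have hyx' : y' ≤ x + 1 := by omega
    -- the exponents of `q` differ by at most one, and if they differ then `c` and `c'` are ends
    rcases lt_trichotomy n n' with hn | hn | hn
    · obtain ⟨k, rfl⟩ := Nat.exists_eq_add_of_lt hn
      have hk : k * (x + 1) = 0 ∧ y = x + 1 ∧ y' = 0 := by
        have : (n + k + 1) * (x + 1) = n * (x + 1) + k * (x + 1) + (x + 1) := by ring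
        omega
      obtain rfl : k = 0 := by simpa using hk.1
      have hc : c = q := Fin.ext (by omega)
      have hc' : c' = p := Fin.ext (by omega)
      subst hc hc'
      obtain rfl : m = m' + 1 := by omega
      simp only [Finsupp.single_add, add_zero]
      abel
    · subst hn
      obtain rfl : m = m' := by omega
      have hc : c = c' := Fin.ext (by omega)
      rw [hc]
    · obtain ⟨k, rfl⟩ := Nat.exists_eq_add_of_lt hn
      have hk : k * (x + 1) = 0 ∧ y' = x + 1 ∧ y = 0 := by
        have : (n' + k + 1) * (x + 1) = n' * (x + 1) + k * (x + 1) + (x + 1) := by ring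
        omega
      obtain rfl : k = 0 := by simpa using hk.1
      have hc : c' = q := Fin.ext (by omega)
      have hc' : c = p := Fin.ext (by omega)
      subst hc hc'
      obtain rfl : m' = m + 1 := by omega
      simp only [Finsupp.single_add, add_zero]
      abel

end Vertices

section VertexIdeal

variable {d : ℕ} (K : Type*) [Field K] (V : Set (Fin (d + 1)))

/-- The monomial ideal generated by the forbidden quadrics of a set of vertices. -/
noncomputable def vertexIdeal : Ideal (MvPolynomial (Fin (d + 1)) K) :=
  Ideal.span ((fun u => monomial u (1 : K)) ''
    {u | ∃ a b, IsForbidden V a b ∧ u = Finsupp.single a 1 + Finsupp.single b 1})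

variable {K V}

theorem mem_vertexIdeal_iff {f : MvPolynomial (Fin (d + 1)) K} :
    f ∈ vertexIdeal K V ↔ ∀ u ∈ f.support, HasForbidden V u := by
  rw [vertexIdeal, mem_ideal_span_monomial_image]
  refine forall₂_congr fun u _ => ?_
  constructor
  · rintro ⟨_, ⟨a, b, h, rfl⟩, hle⟩
    exact ⟨a, b, h, hle⟩
  · rintro ⟨a, b, h, hle⟩
    exact ⟨_, ⟨a, b, h, rfl⟩, hle⟩

theorem monomial_mem_vertexIdeal_iff {u : Fin (d + 1) →₀ ℕ} :
    monomial u (1 : K) ∈ vertexIdeal K V ↔ HasForbidden V u := by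
  classical
  rw [mem_vertexIdeal_iff]
  simp [coeff_monomial]

theorem IsForbidden.X_mul_X_mem {a b : Fin (d + 1)} (h : IsForbidden V a b) :
    (X a * X b : MvPolynomial (Fin (d + 1)) K) ∈ vertexIdeal K V := by
  rw [← single_add_single_eq_X_mul_X, monomial_mem_vertexIdeal_iff]
  exact ⟨a, b, h, le_rfl⟩

theorem vertexIdeal_le_iff {I : Ideal (MvPolynomial (Fin (d + 1)) K)} :
    vertexIdeal K V ≤ I ↔ ∀ a b, IsForbidden V a b → X a * X b ∈ I := by
  rw [vertexIdeal, Ideal.span_le]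
  constructor
  · intro h a b hab
    rw [← single_add_single_eq_X_mul_X]
    exact h ⟨_, ⟨a, b, hab, rfl⟩, rfl⟩
  · rintro h _ ⟨_, ⟨a, b, hab, rfl⟩, rfl⟩
    simp only [SetLike.mem_coe, single_add_single_eq_X_mul_X]
    exact h a b hab

/-- Two exponents of degree two are comparable only if they are equal. -/
theorem eq_or_eq_of_single_add_single_le {σ : Type*} {a b p q : σ}
    (h : Finsupp.single a 1 + Finsupp.single b 1 ≤
      (Finsupp.single p 1 + Finsupp.single q 1 : σ →₀ ℕ)) :
    a = p ∧ b = q ∨ a = q ∧ b = p := by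
  classical
  have single_le : ∀ {x y : σ}, Finsupp.single x 1 ≤ (Finsupp.single y 1 : σ →₀ ℕ) → x = y := by
    intro x y hxy
    by_contra hne
    simp [Finsupp.single_le_iff, Finsupp.single_eq_of_ne hne] at hxy
  by_cases h1 : a = p
  · subst h1
    exact Or.inl ⟨rfl, single_le (le_of_add_le_add_left h)⟩
  · by_cases h2 : a = q
    · subst h2
      rw [add_comm (Finsupp.single p 1)] at h
      exact Or.inr ⟨rfl, single_le (le_of_add_le_add_left h)⟩
    · have ha := h a
      simp [Finsupp.single_eq_of_ne h1, Finsupp.single_eq_of_ne h2] at ha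

theorem hasForbidden_single_add_single_iff {a b : Fin (d + 1)} :
    HasForbidden V (Finsupp.single a 1 + Finsupp.single b 1) ↔ IsForbidden V a b := by
  constructor
  · rintro ⟨a', b', h, hle⟩
    rcases eq_or_eq_of_single_add_single_le hle with ⟨rfl, rfl⟩ | ⟨rfl, rfl⟩
    · exact h
    · exact h.symm
  · exact fun h => ⟨a, b, h, le_rfl⟩

theorem X_mul_X_mem_vertexIdeal_iff {a b : Fin (d + 1)} :
    (X a * X b : MvPolynomial (Fin (d + 1)) K) ∈ vertexIdeal K V ↔ IsForbidden V a b := by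
  rw [← single_add_single_eq_X_mul_X, monomial_mem_vertexIdeal_iff,
    hasForbidden_single_add_single_iff]

/-- If the initial ideal contains the ideal of `V`, the two are equal, since each fibre contains a
monomial outside the former and at most one outside the latter. -/
theorem initialIdeal_curve_eq_vertexIdeal (hd : 1 ≤ d) (h0 : 0 ∈ V) (hl : Fin.last d ∈ V)
    {m : MonomialOrder (Fin (d + 1))}
    (h : vertexIdeal K V ≤ initialIdeal m (rationalNormalCurveIdeal K d)) :
    initialIdeal m (rationalNormalCurveIdeal K d) = vertexIdeal K V := by
  refine le_antisymm (fun f hf => mem_vertexIdeal_iff.2 fun u hu => ?_) h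
  rw [mem_initialIdeal_curve_iff] at hf
  by_contra hV
  obtain ⟨v, hv, hvI⟩ := exists_monomial_notMem_initialIdeal_curve (K := K) m u
  have hvV : ¬ HasForbidden V v := fun hvV => hvI (h (monomial_mem_vertexIdeal_iff.2 hvV))
  obtain rfl := eq_of_not_hasForbidden hd h0 hl hv hvV hV
  exact hvI ((monomial_mem_initialIdeal_curve_iff m v).2 (hf v hu))

/-! ### Columns of the matrix -/

/-- The columns `c < e` lie in different blocks of the matrix cut at the vertices. -/
def IsCut (V : Set (Fin (d + 1))) (c e : Fin d) : Prop :=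
  ∃ i ∈ V, (c : ℕ) < i ∧ (i : ℕ) ≤ e

theorem isForbidden_iff_exists_columns {a b : Fin (d + 1)} (h0 : 0 ∈ V) (hl : Fin.last d ∈ V)
    (hab : a ≤ b) :
    IsForbidden V a b ↔ ∃ c e : Fin d, c < e ∧
      (IsCut V c e ∧ a = c.castSucc ∧ b = e.succ ∨
        ¬ IsCut V c e ∧ a = c.succ ∧ b = e.castSucc) := by
  constructor
  · intro h
    by_cases hi : ∃ i ∈ V, a < i ∧ i < b
    · obtain ⟨i, hi, h1, h2⟩ := hi
      rw [Fin.lt_def] at h1 h2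
      refine ⟨⟨a, by omega⟩, ⟨b - 1, by omega⟩, Fin.lt_def.2 (by simp; omega), Or.inl
        ⟨⟨i, hi, h1, by simp; omega⟩, rfl, Fin.ext (by simp; omega)⟩⟩
    · have hV : a ∉ V ∧ b ∉ V := by
        rcases h with h | ⟨i, -, h1, h2⟩ | h
        · exact absurd h hi
        · exact absurd (h1.trans h2) (not_lt.2 hab)
        · exact h
      have ha0 : a ≠ 0 := by rintro rfl; exact hV.1 h0
      have hbl : b ≠ Fin.last d := by rintro rfl; exact hV.2 hl
      have ha0' : (a : ℕ) ≠ 0 := fun h => ha0 (Fin.ext h)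
      have hbl' : (b : ℕ) ≠ d := fun h => hbl (Fin.ext h)
      have hab' := Fin.le_def.1 hab
      refine ⟨⟨a - 1, by omega⟩, ⟨b, by omega⟩, Fin.lt_def.2 (by simp; omega), Or.inr
        ⟨?_, Fin.ext (by simp; omega), rfl⟩⟩
      rintro ⟨i, hiV, h1, h2⟩
      simp only at h1 h2
      have hia : i ≠ a := by rintro rfl; exact hV.1 hiV
      have hib : i ≠ b := by rintro rfl; exact hV.2 hiV
      exact hi ⟨i, hiV, by omega, by omega⟩
  · rintro ⟨c, e, hce, ⟨⟨i, hi, h1, h2⟩, rfl, rfl⟩ | ⟨h, rfl, rfl⟩⟩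
    · exact Or.inl ⟨i, hi, Fin.lt_def.2 (by simpa using h1), Fin.lt_def.2 (by simp; omega)⟩
    · refine Or.inr (Or.inr ⟨fun hV => h ⟨_, hV, ?_, ?_⟩, fun hV => h ⟨_, hV, ?_, ?_⟩⟩) <;>
        simp <;> omega

end VertexIdeal

/-! ### Sequences of vertices -/

namespace BreakSeq

variable {d : ℕ} (s : BreakSeq d)

/-- The set of members of the sequence. -/
def vertices : Set (Fin (d + 1)) := Set.range s.i

theorem zero_mem_vertices : 0 ∈ s.vertices := ⟨0, s.first⟩

theorem last_mem_vertices : Fin.last d ∈ s.vertices := ⟨Fin.last s.k, s.last⟩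

theorem k_pos (hd : 1 ≤ d) : 0 < s.k := by
  by_contra! h0
  have h1 := s.last
  have h2 : Fin.last s.k = 0 := Fin.ext (by simp; omega)
  rw [h2, s.first] at h1
  have := congrArg Fin.val h1
  simp at this
  omega

theorem isEdge_iff {p q : Fin (d + 1)} :
    IsEdge s.vertices p q ↔ ∃ j : Fin s.k, p = s.i j.castSucc ∧ q = s.i j.succ := by
  constructor
  · rintro ⟨⟨j, rfl⟩, ⟨j', rfl⟩, hlt, h⟩
    have hjj := s.strictMono.lt_iff_lt.1 hlt
    have hj : j ≠ Fin.last s.k := fun hj => absurd (Fin.le_last j') (not_le.2 (hj ▸ hjj))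
    refine ⟨j.castPred hj, by simp, ?_⟩
    congr 1
    have h1 := h (s.i (j.castPred hj).succ) ⟨_, rfl⟩
    rw [s.strictMono.le_iff_le, s.strictMono.le_iff_le, Fin.le_def, Fin.le_def] at h1
    rw [Fin.lt_def] at hjj
    ext
    simp only [Fin.val_succ, Fin.coe_castPred] at h1 ⊢
    omega
  · rintro ⟨j, rfl, rfl⟩
    refine ⟨⟨_, rfl⟩, ⟨_, rfl⟩, s.strictMono Fin.castSucc_lt_succ, ?_⟩
    rintro _ ⟨l, rfl⟩
    rw [s.strictMono.le_iff_le, s.strictMono.le_iff_le, Fin.le_def, Fin.le_def]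
    simp only [Fin.val_succ, Fin.val_castSucc]
    omega

theorem separates_iff {c e : Fin d} : s.Separates c e ↔ IsCut s.vertices c e := by
  constructor
  · rintro ⟨j, h1, h2⟩
    exact ⟨_, ⟨j, rfl⟩, h1, h2⟩
  · rintro ⟨_, ⟨j, rfl⟩, h1, h2⟩
    exact ⟨j, h1, h2⟩

theorem sameBlock_iff {c e : Fin d} :
    s.SameBlock c e ↔ ¬ IsCut s.vertices c e := by
  constructor
  · rintro ⟨j, h1, h2⟩ ⟨i, hi, h3, h4⟩
    have := (s.isEdge_iff.2 ⟨j, rfl, rfl⟩).le_or_le i hi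
    omega
  · intro h
    obtain ⟨p, q, he, hp, hq⟩ := exists_isEdge_le_lt s.zero_mem_vertices s.last_mem_vertices
      (j := c.castSucc) (Fin.castSucc_lt_last c)
    have hqV := he.right
    obtain ⟨j, rfl, rfl⟩ := s.isEdge_iff.1 he
    refine ⟨j, hp, ?_⟩
    by_contra! hle
    exact h ⟨_, hqV, hq, hle⟩

theorem ideal_eq_vertexIdeal (K : Type*) [Field K] : s.ideal K = vertexIdeal K s.vertices := by
  refine le_antisymm (Ideal.span_le.2 ?_) (vertexIdeal_le_iff.2 fun a b hab => ?_)
  · rintro _ (⟨c, e, hce, h, rfl⟩ | ⟨c, e, hce, h, rfl⟩)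
    · refine X_mul_X_mem_vertexIdeal_iff.2 ((isForbidden_iff_exists_columns s.zero_mem_vertices
        s.last_mem_vertices ?_).2 ⟨c, e, hce, Or.inl ⟨s.separates_iff.1 h, rfl, rfl⟩⟩)
      rw [Fin.le_def]; simp; omega
    · refine X_mul_X_mem_vertexIdeal_iff.2 ((isForbidden_iff_exists_columns s.zero_mem_vertices
        s.last_mem_vertices ?_).2 ⟨c, e, hce, Or.inr ⟨s.sameBlock_iff.1 h, rfl, rfl⟩⟩)
      rw [Fin.le_def]; simp; omega
  · wlog hle : a ≤ b generalizing a b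
    · rw [mul_comm]
      exact this b a hab.symm (le_of_not_ge hle)
    obtain ⟨c, e, hce, ⟨h, rfl, rfl⟩ | ⟨h, rfl, rfl⟩⟩ :=
      (isForbidden_iff_exists_columns s.zero_mem_vertices s.last_mem_vertices hle).1 hab
    · exact Ideal.subset_span (Or.inl ⟨c, e, hce, s.separates_iff.2 h, rfl⟩)
    · exact Ideal.subset_span (Or.inr ⟨c, e, hce, s.sameBlock_iff.2 h, rfl⟩)

end BreakSeq

/-! ### Term orders refining a weight -/

section WeightOrder

variable {σ : Type} (a : σ → ℕ)

/-- The additive map sending an exponent to its weight, followed by the exponent itself. -/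
noncomputable def weightLexHom : (σ →₀ ℕ) →+ ℕ ×ₗ Lex (σ →₀ ℕ) where
  toFun u := toLex (Finsupp.weight a u, toLex u)
  map_zero' := by simp
  map_add' u v := by simp; rfl

theorem weightLexHom_injective : Function.Injective (weightLexHom a) := by
  intro u v h
  exact toLex.injective (congrArg Prod.snd (toLex.injective h))

/-- Exponents, identified with the image of `weightLexHom`. -/
noncomputable def weightLexEquiv : (σ →₀ ℕ) ≃+ AddMonoidHom.mrange (weightLexHom a) :=
  AddEquiv.mk' (Equiv.ofBijective (weightLexHom a).mrangeRestrict
    ⟨fun _ _ h => weightLexHom_injective a (congrArg Subtype.val h),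
      (weightLexHom a).mrangeRestrict_surjective⟩) (map_add (weightLexHom a).mrangeRestrict)

variable [LinearOrder σ] [Finite σ]

/-- The term order comparing weights first and breaking ties lexicographically. -/
noncomputable def weightLexOrder : MonomialOrder.{0, 0} σ where
  syn := AddMonoidHom.mrange (weightLexHom a)
  toSyn := weightLexEquiv a
  toSyn_monotone u v h := by
    obtain ⟨w, rfl⟩ := exists_add_of_le h
    change weightLexHom a u ≤ weightLexHom a (u + w)
    refine Prod.Lex.toLex_le_toLex.2 ?_
    simp only [map_add]
    rcases Nat.eq_zero_or_pos (Finsupp.weight a w) with h0 | h0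
    · exact Or.inr ⟨by simp [h0], Finsupp.toLex_monotone le_self_add⟩
    · exact Or.inl (by simpa using h0)
  wellFoundedLT_syn := ⟨InvImage.wf Subtype.val wellFounded_lt⟩

theorem refinesWeight_weightLexOrder : RefinesWeight (weightLexOrder a) a := fun u v h => by
  change weightLexHom a u < weightLexHom a v
  exact Prod.Lex.toLex_lt_toLex.2 (Or.inl h)

end WeightOrder

/-! ### A weight selecting the ideal of a set of vertices -/

section Weight

variable {d : ℕ} (V : Set (Fin (d + 1)))

/-- The weight of the variable `t_j`. It jumps from `t_l` to `t_{l + 1}` by `2 d n - (2 l + 1)`,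
where `n` is the number of vertices up to `l`: the jumps grow at the vertices, and decrease in
between. -/
noncomputable def vertexWeight (j : Fin (d + 1)) : ℕ :=
  ∑ l ∈ Finset.range j, (2 * d * {i ∈ V | (i : ℕ) ≤ l}.ncard - (2 * l + 1))

variable {V}

theorem one_le_ncard_vertices_le (h0 : 0 ∈ V) (l : ℕ) : 1 ≤ {i ∈ V | (i : ℕ) ≤ l}.ncard :=
  (Set.ncard_pos (Set.toFinite _)).2 ⟨0, h0, by simp⟩

theorem vertexWeight_succ (h0 : 0 ∈ V) (c : Fin d) :
    vertexWeight V c.succ + (2 * c + 1) =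
      vertexWeight V c.castSucc + 2 * d * {i ∈ V | (i : ℕ) ≤ c}.ncard := by
  rw [vertexWeight, vertexWeight, Fin.val_succ, Fin.val_castSucc, Finset.sum_range_succ]
  have h1 := Nat.mul_le_mul_left (2 * d) (one_le_ncard_vertices_le h0 c)
  have := c.2
  omega

theorem vertexWeight_zero : vertexWeight V 0 = 0 := by simp [vertexWeight]

theorem vertexWeight_strictMono (h0 : 0 ∈ V) : StrictMono (vertexWeight V) := by
  rw [Fin.strictMono_iff_lt_succ]
  intro c
  have h1 := Nat.mul_le_mul_left (2 * d) (one_le_ncard_vertices_le h0 c)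
  have h2 := vertexWeight_succ h0 c
  have := c.2
  omega

theorem vertexWeight_lt_of_isCut (h0 : 0 ∈ V) {c e : Fin d} (hce : c < e) (h : IsCut V c e) :
    vertexWeight V c.succ + vertexWeight V e.castSucc <
      vertexWeight V c.castSucc + vertexWeight V e.succ := by
  obtain ⟨i, hi, h1, h2⟩ := h
  have hlt : {i ∈ V | (i : ℕ) ≤ c}.ncard < {i ∈ V | (i : ℕ) ≤ e}.ncard := by
    refine Set.ncard_lt_ncard ⟨fun x hx => ⟨hx.1, ?_⟩, fun hsub => ?_⟩ (Set.toFinite _)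
    · have := hx.2
      omega
    · have := (hsub (a := i) ⟨hi, h2⟩).2
      omega
  have h3 := Nat.mul_le_mul_left (2 * d) hlt
  rw [Nat.mul_succ] at h3
  have h4 := vertexWeight_succ h0 c
  have h5 := vertexWeight_succ h0 e
  omega

theorem vertexWeight_lt_of_not_isCut (h0 : 0 ∈ V) {c e : Fin d} (hce : c < e)
    (h : ¬ IsCut V c e) :
    vertexWeight V c.castSucc + vertexWeight V e.succ <
      vertexWeight V c.succ + vertexWeight V e.castSucc := by
  have heq : {i ∈ V | (i : ℕ) ≤ c} = {i ∈ V | (i : ℕ) ≤ e} := by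
    ext i
    refine and_congr_right fun hi => ⟨fun h1 => by omega, fun h1 => ?_⟩
    by_contra! h2
    exact h ⟨i, hi, h2, h1⟩
  have h4 := vertexWeight_succ h0 c
  have h5 := vertexWeight_succ h0 e
  rw [heq] at h4
  omega

/-- A monomial of the ideal of `V` is not of least weight in its fibre: one of its forbidden
quadrics can be exchanged for the other term of a `2`-minor. -/
theorem HasForbidden.exists_weight_lt (hd : 1 ≤ d) (h0 : 0 ∈ V) (hl : Fin.last d ∈ V)
    {u : Fin (d + 1) →₀ ℕ} (h : HasForbidden V u) :
    ∃ v, curveExponent d v = curveExponent d u ∧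
      Finsupp.weight (vertexWeight V) v < Finsupp.weight (vertexWeight V) u := by
  obtain ⟨a, b, hab, hle⟩ := h
  wlog hab' : a ≤ b generalizing a b
  · exact this b a hab.symm ((add_comm _ _).trans_le hle) (le_of_not_ge hab')
  obtain ⟨r, rfl⟩ := exists_add_of_le hle
  obtain ⟨c, e, hce, ⟨h, rfl, rfl⟩ | ⟨h, rfl, rfl⟩⟩ :=
    (isForbidden_iff_exists_columns h0 hl hab').1 hab
  · refine ⟨Finsupp.single c.succ 1 + Finsupp.single e.castSucc 1 + r, ?_, ?_⟩
    · rw [curveExponent_eq_iff hd]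
      simp
      omega
    · simpa [Finsupp.weight_single] using vertexWeight_lt_of_isCut h0 hce h
  · refine ⟨Finsupp.single c.castSucc 1 + Finsupp.single e.succ 1 + r, ?_, ?_⟩
    · rw [curveExponent_eq_iff hd]
      simp
      omega
    · simpa [Finsupp.weight_single] using vertexWeight_lt_of_not_isCut h0 hce h

theorem weight_lt_of_not_hasForbidden (hd : 1 ≤ d) (h0 : 0 ∈ V) (hl : Fin.last d ∈ V)
    {u v : Fin (d + 1) →₀ ℕ} (hu : ¬ HasForbidden V u)
    (huv : curveExponent d v = curveExponent d u) (hne : v ≠ u) :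
    Finsupp.weight (vertexWeight V) u < Finsupp.weight (vertexWeight V) v := by
  induction hn : Finsupp.weight (vertexWeight V) v using Nat.strong_induction_on generalizing v with
  | h n ih =>
    subst hn
    have hv : HasForbidden V v := by
      by_contra hv
      exact hne (eq_of_not_hasForbidden hd h0 hl huv hv hu)
    obtain ⟨w, hw, hlt⟩ := hv.exists_weight_lt hd h0 hl
    by_cases hwu : w = u
    · exact hwu ▸ hlt
    · exact (ih _ hlt (hw.trans huv) hwu rfl).trans hlt

variable {K : Type*} [Field K]

theorem mem_support_weightInitialForm {σ : Type*} {a : σ → ℕ} {f : MvPolynomial σ K}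
    {u : σ →₀ ℕ} : u ∈ (weightInitialForm a f).support ↔
      u ∈ f.support ∧ Finsupp.weight a u = weightedTotalDegree a f := by
  classical
  rw [mem_support_iff, weightInitialForm, coeff_weightedHomogeneousComponent, mem_support_iff]
  split_ifs with h <;> simp [h]

theorem weightInitialForm_monomial_sub_monomial {σ : Type*} {a : σ → ℕ} {u v : σ →₀ ℕ}
    (h : Finsupp.weight a v < Finsupp.weight a u) :
    weightInitialForm a (monomial u (1 : K) - monomial v 1) = monomial u 1 := by
  classical
  have hvu : v ≠ u := by rintro rfl; exact lt_irrefl _ h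
  have hdeg : weightedTotalDegree a (monomial u (1 : K) - monomial v 1) = Finsupp.weight a u := by
    refine le_antisymm (Finset.sup_le fun x hx => ?_) (le_weightedTotalDegree a ?_)
    · rw [mem_support_iff, coeff_sub, coeff_monomial, coeff_monomial] at hx
      by_cases h1 : u = x
      · rw [h1]
      · by_cases h2 : v = x
        · rw [← h2]
          exact h.le
        · simp [h1, h2] at hx
    · simp [coeff_monomial, hvu]
  ext x
  rw [weightInitialForm, hdeg, coeff_weightedHomogeneousComponent, coeff_sub, coeff_monomial,
    coeff_monomial]
  by_cases h1 : u = x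
  · subst h1
    simp [hvu]
  · by_cases h2 : v = x
    · subst h2
      simp [h.ne, h1]
    · simp [h1, h2]

theorem weightInitialIdeal_curve_eq_vertexIdeal (hd : 1 ≤ d) (h0 : 0 ∈ V) (hl : Fin.last d ∈ V) :
    weightInitialIdeal (vertexWeight V) (rationalNormalCurveIdeal K d) = vertexIdeal K V := by
  refine le_antisymm (Ideal.span_le.2 ?_) (vertexIdeal_le_iff.2 fun a b hab => ?_)
  · rintro _ ⟨f, hf, -, rfl⟩
    refine mem_vertexIdeal_iff.2 fun u hu => ?_
    rw [mem_support_weightInitialForm] at hu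
    by_contra hV
    obtain ⟨v, hv, hne, hvu⟩ := exists_ne_mem_support_of_mem_curveIdeal hf hu.1
    have h1 := weight_lt_of_not_hasForbidden hd h0 hl hV hvu hne
    have h2 := le_weightedTotalDegree (vertexWeight V) hv
    omega
  · obtain ⟨v, hv, hlt⟩ :=
      (hasForbidden_single_add_single_iff.2 hab).exists_weight_lt hd h0 hl
    rw [← single_add_single_eq_X_mul_X]
    refine Ideal.subset_span ⟨_, monomial_sub_monomial_mem_curveIdeal hv.symm,
      monomial_sub_monomial_ne_zero ?_, (weightInitialForm_monomial_sub_monomial hlt).symm⟩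
    intro h
    rw [h] at hlt
    exact lt_irrefl _ hlt

theorem RefinesWeight.initialIdeal_curve_eq (hd : 1 ≤ d) (h0 : 0 ∈ V) (hl : Fin.last d ∈ V)
    {m : MonomialOrder (Fin (d + 1))} (hm : RefinesWeight m (vertexWeight V)) :
    initialIdeal m (rationalNormalCurveIdeal K d) = vertexIdeal K V := by
  refine initialIdeal_curve_eq_vertexIdeal hd h0 hl (vertexIdeal_le_iff.2 fun a b hab => ?_)
  rw [← single_add_single_eq_X_mul_X, monomial_mem_initialIdeal_curve_iff]
  obtain ⟨v, hv, hlt⟩ := (hasForbidden_single_add_single_iff.2 hab).exists_weight_lt hd h0 hl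
  exact ⟨v, hv, hm _ _ hlt⟩

theorem curveMinor_eq (c e : Fin d) :
    curveMinor K d c e = X c.castSucc * X e.succ - X c.succ * X e.castSucc := by
  rw [curveMinor, Matrix.det_fin_two]
  simp [curveMatrix]
  ring

theorem initialMonomial_X_mul_X_sub {σ : Type*} {m : MonomialOrder σ} {a b p q : σ}
    (h : m.toSyn (Finsupp.single p 1 + Finsupp.single q 1) <
      m.toSyn (Finsupp.single a 1 + Finsupp.single b 1)) :
    initialMonomial m (X a * X b - X p * X q : MvPolynomial σ K) = X a * X b := by
  rw [initialMonomial, ← single_add_single_eq_X_mul_X, ← single_add_single_eq_X_mul_X,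
    degree_monomial_sub_monomial m h]

theorem initialMonomial_neg {σ : Type*} (m : MonomialOrder σ) (f : MvPolynomial σ K) :
    initialMonomial m (-f) = initialMonomial m f := by
  simp [initialMonomial, MonomialOrder.degree_neg]

theorem RefinesWeight.initialMonomial_curveMinor_of_isCut (h0 : 0 ∈ V)
    {m : MonomialOrder (Fin (d + 1))} (hm : RefinesWeight m (vertexWeight V)) {c e : Fin d}
    (hce : c < e) (h : IsCut V c e) :
    initialMonomial m (curveMinor K d c e) = X c.castSucc * X e.succ := by
  rw [curveMinor_eq]
  refine initialMonomial_X_mul_X_sub (hm _ _ ?_)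
  simpa [Finsupp.weight_single] using vertexWeight_lt_of_isCut h0 hce h

theorem RefinesWeight.initialMonomial_curveMinor_of_not_isCut (h0 : 0 ∈ V)
    {m : MonomialOrder (Fin (d + 1))} (hm : RefinesWeight m (vertexWeight V)) {c e : Fin d}
    (hce : c < e) (h : ¬ IsCut V c e) :
    initialMonomial m (curveMinor K d c e) = X c.succ * X e.castSucc := by
  rw [curveMinor_eq, ← initialMonomial_neg, neg_sub]
  refine initialMonomial_X_mul_X_sub (hm _ _ ?_)
  simpa [Finsupp.weight_single] using vertexWeight_lt_of_not_isCut h0 hce h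

end Weight

namespace BreakSeq

variable {d : ℕ} (s : BreakSeq d) {K : Type*} [Field K]

/-! ### The reduced Gröbner basis -/

/-- A rule rewrites a forbidden quadric into the allowed quadric of the same fibre. -/
theorem IsRule.spec (hd : 1 ≤ d) {a b p q : Fin (d + 1)} (h : s.IsRule a b p q) :
    IsForbidden s.vertices a b ∧ ¬ IsForbidden s.vertices p q ∧
      curveExponent d (Finsupp.single a 1 + Finsupp.single b 1) =
        curveExponent d (Finsupp.single p 1 + Finsupp.single q 1) := by
  obtain ⟨hsum, hap, haq, v, hv⟩ := h
  have hE : curveExponent d (Finsupp.single a 1 + Finsupp.single b 1) =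
      curveExponent d (Finsupp.single p 1 + Finsupp.single q 1) := by
    rw [curveExponent_eq_iff hd]
    simp
    omega
  have hpq : ¬ IsForbidden s.vertices p q := by
    rw [not_isForbidden_iff hd s.zero_mem_vertices s.last_mem_vertices]
    have he := s.isEdge_iff.2 ⟨v, rfl, rfl⟩
    have hlt := he.lt
    refine ⟨_, _, he, ?_⟩
    rcases hv with ⟨rfl, h1, h2⟩ | ⟨rfl, h1, h2⟩
    · refine ⟨le_rfl, hlt.le, ?_, ?_, Or.inl rfl⟩ <;> omega
    · refine ⟨hlt.le, le_rfl, ?_, ?_, Or.inr (Or.inl rfl)⟩ <;> omega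
  refine ⟨?_, hpq, hE⟩
  by_contra hab
  have := eq_of_not_hasForbidden hd s.zero_mem_vertices s.last_mem_vertices hE
    (mt hasForbidden_single_add_single_iff.1 hab) (mt hasForbidden_single_add_single_iff.1 hpq)
  rcases eq_or_eq_of_single_add_single_le this.le with ⟨rfl, rfl⟩ | ⟨rfl, rfl⟩
  · exact hap rfl
  · exact haq rfl

theorem exists_isRule (hd : 1 ≤ d) {a b : Fin (d + 1)} (h : IsForbidden s.vertices a b) :
    ∃ p q, s.IsRule a b p q := by
  have hab : (a : ℕ) + b < 2 * d := by
    by_contra! hle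
    have ha : a = Fin.last d := Fin.ext (by simp; omega)
    have hb : b = Fin.last d := Fin.ext (by simp; omega)
    rcases h with ⟨i, -, h1, h2⟩ | ⟨i, -, h1, h2⟩ | ⟨h1, -⟩
    · omega
    · omega
    · exact h1 (ha ▸ s.last_mem_vertices)
  -- the edge around half the sum of the indices
  obtain ⟨p, q, he, hp, hq⟩ := exists_isEdge_le_lt s.zero_mem_vertices s.last_mem_vertices
    (j := ⟨(a + b) / 2, by omega⟩) (Fin.lt_def.2 (by simp; omega))
  simp only [Fin.le_def, Fin.lt_def] at hp hq
  have hne : ∀ r t : Fin (d + 1), (r = p ∨ r = q) → p ≤ t → t ≤ q → (r : ℕ) + t = a + b →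
      a ≠ r ∧ a ≠ t := by
    intro r t hr h1 h2 hsum
    have hlt := he.lt
    constructor
    · rintro rfl
      obtain rfl : b = t := Fin.ext (by omega)
      refine (not_isForbidden_iff hd s.zero_mem_vertices s.last_mem_vertices).2
        ⟨p, q, he, ?_, ?_, h1, h2, by tauto⟩ h
      · rcases hr with rfl | rfl <;> omega
      · rcases hr with rfl | rfl <;> omega
    · rintro rfl
      obtain rfl : b = r := Fin.ext (by omega)
      refine (not_isForbidden_iff hd s.zero_mem_vertices s.last_mem_vertices).2
        ⟨p, q, he, h1, h2, ?_, ?_, by tauto⟩ h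
      · rcases hr with rfl | rfl <;> omega
      · rcases hr with rfl | rfl <;> omega
  obtain ⟨v, hpv, hqv⟩ := s.isEdge_iff.1 he
  rcases le_total ((a : ℕ) + b) (p + q) with hle | hle
  · obtain ⟨h1, h2⟩ := hne p ⟨a + b - p, by omega⟩ (Or.inl rfl)
      (Fin.le_def.2 (by simp; omega)) (Fin.le_def.2 (by simp; omega)) (by simp; omega)
    refine ⟨p, ⟨a + b - p, by omega⟩, by simp; omega, h1, h2, v, Or.inl ⟨hpv, ?_, ?_⟩⟩
    · rw [← hpv]; omega
    · rw [← hpv, ← hqv]; omega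
  · obtain ⟨h1, h2⟩ := hne q ⟨a + b - q, by omega⟩ (Or.inr rfl)
      (Fin.le_def.2 (by simp; omega)) (Fin.le_def.2 (by simp; omega)) (by simp; omega)
    refine ⟨q, ⟨a + b - q, by omega⟩, by simp; omega, h1, h2, v, Or.inr ⟨hqv, ?_, ?_⟩⟩
    · rw [← hpv, ← hqv]; omega
    · rw [← hqv]; omega

theorem IsRule.toSyn_lt (hd : 1 ≤ d) {m : MonomialOrder (Fin (d + 1))}
    (hm : initialIdeal m (rationalNormalCurveIdeal K d) = s.ideal K) {a b p q : Fin (d + 1)}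
    (h : s.IsRule a b p q) :
    m.toSyn (Finsupp.single p 1 + Finsupp.single q 1) <
      m.toSyn (Finsupp.single a 1 + Finsupp.single b 1) := by
  obtain ⟨-, hpq, hE⟩ := IsRule.spec s hd h
  refine lt_of_not_ge fun hle => ?_
  rcases hle.lt_or_eq with hlt | heq
  · refine hpq (X_mul_X_mem_vertexIdeal_iff (K := K).1 ?_)
    rw [← s.ideal_eq_vertexIdeal, ← hm, ← single_add_single_eq_X_mul_X,
      monomial_mem_initialIdeal_curve_iff]
    exact ⟨_, hE, hlt⟩
  · rcases eq_or_eq_of_single_add_single_le (m.toSyn.injective heq).le with ⟨h1, -⟩ | ⟨h1, -⟩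
    · exact h.2.1 h1
    · exact h.2.2.1 h1

theorem isReducedGroebnerBasis_binomials (hd : 1 ≤ d) {m : MonomialOrder (Fin (d + 1))}
    (hm : initialIdeal m (rationalNormalCurveIdeal K d) = s.ideal K) :
    IsReducedGroebnerBasis m (rationalNormalCurveIdeal K d) (s.binomials K) := by
  classical
  have hform : ∀ a b p q : Fin (d + 1), (X a * X b - X p * X q : MvPolynomial (Fin (d + 1)) K) =
      monomial (Finsupp.single a 1 + Finsupp.single b 1) 1 -
        monomial (Finsupp.single p 1 + Finsupp.single q 1) 1 := fun a b p q => by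
    rw [single_add_single_eq_X_mul_X, single_add_single_eq_X_mul_X]
  refine ⟨?_, ?_, ?_, ?_, ?_⟩
  · rintro _ ⟨a, b, p, q, h, rfl⟩
    rw [hform]
    exact monomial_sub_monomial_mem_curveIdeal (IsRule.spec s hd h).2.2
  · rintro _ ⟨a, b, p, q, h, rfl⟩
    rw [hform]
    refine monomial_sub_monomial_ne_zero fun he => ?_
    have := IsRule.toSyn_lt s hd hm h
    rw [he] at this
    exact lt_irrefl _ this
  · rw [hm, s.ideal_eq_vertexIdeal]
    refine le_antisymm (Ideal.span_le.2 ?_) (vertexIdeal_le_iff.2 fun a b hab => ?_)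
    · rintro _ ⟨_, ⟨a, b, p, q, h, rfl⟩, rfl⟩
      rw [initialMonomial_X_mul_X_sub (IsRule.toSyn_lt s hd hm h)]
      exact (IsRule.spec s hd h).1.X_mul_X_mem
    · obtain ⟨p, q, h⟩ := s.exists_isRule hd hab
      rw [← initialMonomial_X_mul_X_sub (K := K) (IsRule.toSyn_lt s hd hm h)]
      exact Ideal.subset_span ⟨_, ⟨a, b, p, q, h, rfl⟩, rfl⟩
  · rintro _ ⟨a, b, p, q, h, rfl⟩
    have hlt := IsRule.toSyn_lt s hd hm h
    have hne : Finsupp.single p 1 + Finsupp.single q 1 ≠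
        (Finsupp.single a 1 + Finsupp.single b 1 : Fin (d + 1) →₀ ℕ) := by
      intro he
      rw [he] at hlt
      exact lt_irrefl _ hlt
    rw [hform, MonomialOrder.leadingCoeff, degree_monomial_sub_monomial m hlt]
    simp [coeff_monomial, hne]
  · rintro _ ⟨a, b, p, q, h, rfl⟩ _ ⟨a', b', p', q', h', rfl⟩ hne α hα hle
    obtain ⟨hab, hpq, hE⟩ := IsRule.spec s hd h
    obtain ⟨hab', hpq', hE'⟩ := IsRule.spec s hd h'
    rw [hform, degree_monomial_sub_monomial m (IsRule.toSyn_lt s hd hm h')] at hle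
    have hα' : α = Finsupp.single a 1 + Finsupp.single b 1 ∨
        α = Finsupp.single p 1 + Finsupp.single q 1 := by
      by_contra! hcon
      rw [hform, mem_support_iff, coeff_sub, coeff_monomial, coeff_monomial,
        if_neg hcon.1.symm, if_neg hcon.2.symm, sub_zero] at hα
      exact hα rfl
    rcases hα' with rfl | rfl
    · -- equal initial monomials have the same fibre, hence the same allowed quadric
      have hEq : (Finsupp.single a' 1 + Finsupp.single b' 1 : Fin (d + 1) →₀ ℕ) =
          Finsupp.single a 1 + Finsupp.single b 1 := by
        rcases eq_or_eq_of_single_add_single_le hle with ⟨rfl, rfl⟩ | ⟨rfl, rfl⟩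
        · rfl
        · exact add_comm _ _
      have hEq' := eq_of_not_hasForbidden hd s.zero_mem_vertices s.last_mem_vertices
        (hE'.symm.trans ((congrArg _ hEq).trans hE))
        (mt hasForbidden_single_add_single_iff.1 hpq')
        (mt hasForbidden_single_add_single_iff.1 hpq)
      exact hne (by rw [hform, hform, hEq, hEq'])
    · exact hpq (hasForbidden_single_add_single_iff.1 ⟨a', b', hab', hle⟩)

/-! ### The radical -/

/-- The radical is contained in the ideal of the coordinate plane of each edge, which is generated
by the variables other than the two ends of the edge. -/
theorem mem_edgeIdeal_of_mem_radical {p q : Fin (d + 1)} {V : Set (Fin (d + 1))}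
    (he : IsEdge V p q) {f : MvPolynomial (Fin (d + 1)) K} (hf : f ∈ (vertexIdeal K V).radical) :
    f ∈ Ideal.span (X '' {j : Fin (d + 1) | j ≠ p ∧ j ≠ q} :
      Set (MvPolynomial (Fin (d + 1)) K)) := by
  have hprime := isPrime_span_X_image (K := K) {j : Fin (d + 1) | j ≠ p ∧ j ≠ q}
  refine hprime.radical_le_iff.2 (vertexIdeal_le_iff.2 fun a b hab => ?_) hf
  by_cases ha : a ≠ p ∧ a ≠ q
  · exact Ideal.mul_mem_right _ _ (Ideal.subset_span ⟨a, ha, rfl⟩)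
  · by_cases hb : b ≠ p ∧ b ≠ q
    · exact Ideal.mul_mem_left _ _ (Ideal.subset_span ⟨b, hb, rfl⟩)
    · exfalso
      have hlt := he.lt
      rcases hab with ⟨i, hi, h1, h2⟩ | ⟨i, hi, h1, h2⟩ | ⟨h1, h2⟩
      · have := he.le_or_le i hi
        omega
      · have := he.le_or_le i hi
        omega
      · have h3 : a = p ∨ a = q := by tauto
        rcases h3 with rfl | rfl
        · exact h1 he.left
        · exact h1 he.right

theorem radical_ideal (hd : 1 ≤ d) : (s.ideal K).radical = s.radicalIdeal K := by
  classical
  rw [s.ideal_eq_vertexIdeal]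
  apply le_antisymm
  · intro f hf
    rw [f.as_sum]
    refine Ideal.sum_mem _ fun u hu => ?_
    -- a monomial divisible by a generator lies in the ideal
    have hX : ∀ j, j ∉ s.vertices → u j ≠ 0 → monomial u (coeff u f) ∈ s.radicalIdeal K := by
      intro j hj hu0
      obtain ⟨r, rfl⟩ := exists_add_of_le (Finsupp.single_le_iff.2 (Nat.one_le_iff_ne_zero.2 hu0))
      rw [add_comm (Finsupp.single j 1), ← mul_one (coeff _ _), ← monomial_mul]
      exact Ideal.mul_mem_left _ _ (Ideal.subset_span (Or.inl ⟨j, hj, rfl⟩))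
    have hXX : ∀ v w : Fin (s.k + 1), (v : ℕ) + 2 ≤ w → u (s.i v) ≠ 0 → u (s.i w) ≠ 0 →
        monomial u (coeff u f) ∈ s.radicalIdeal K := by
      intro v w hvw hv hw
      have hne : s.i v ≠ s.i w := s.strictMono.injective.ne (by omega)
      have hle : Finsupp.single (s.i v) 1 + Finsupp.single (s.i w) 1 ≤ u := by
        intro j
        simp only [Finsupp.add_apply, Finsupp.single_apply]
        split_ifs with h1 h2 h2
        · exact absurd (h1.trans h2.symm) hne
        · subst h1; omega
        · subst h2; omega
        · omega
      obtain ⟨r, rfl⟩ := exists_add_of_le hle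
      rw [add_comm _ r, ← mul_one (coeff _ _), ← monomial_mul, single_add_single_eq_X_mul_X]
      exact Ideal.mul_mem_left _ _ (Ideal.subset_span (Or.inr ⟨v, w, hvw, rfl⟩))
    by_contra hmem
    -- otherwise the support of the monomial lies in an edge
    obtain ⟨p, q, he, hpq⟩ : ∃ p q, IsEdge s.vertices p q ∧ ∀ j, u j ≠ 0 → j = p ∨ j = q := by
      have hV : ∀ j, u j ≠ 0 → ∃ v, s.i v = j := fun j hj => by
        by_contra hcon
        exact hmem (hX j hcon hj)
      have hk := s.k_pos hd
      by_cases hu0 : ∃ v, u (s.i v) ≠ 0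
      · obtain ⟨v, hv, hmin⟩ := Finset.exists_min_image
          (Finset.univ.filter fun v => u (s.i v) ≠ 0) id (by simpa [Finset.Nonempty] using hu0)
        simp only [Finset.mem_filter, Finset.mem_univ, true_and, id_eq] at hv hmin
        have key : ∀ w, u (s.i w) ≠ 0 → w = v ∨ (w : ℕ) = v + 1 := by
          intro w hw
          have h1 := hmin w hw
          by_contra! hcon
          have h2 : (w : ℕ) ≠ v := fun h => hcon.1 (Fin.ext h)
          exact hmem (hXX v w (by have := Fin.le_def.1 h1; omega) hv hw)
        by_cases hvl : v = Fin.last s.k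
        · refine ⟨_, _, s.isEdge_iff.2 ⟨⟨s.k - 1, by omega⟩, rfl, rfl⟩, fun j hj => ?_⟩
          obtain ⟨w, rfl⟩ := hV j hj
          right
          congr 1
          have := w.2
          rcases key w hj with rfl | h
          · ext; simp [hvl]; omega
          · rw [hvl] at h; simp at h; omega
        · refine ⟨_, _, s.isEdge_iff.2 ⟨v.castPred hvl, rfl, rfl⟩, fun j hj => ?_⟩
          obtain ⟨w, rfl⟩ := hV j hj
          rcases key w hj with rfl | h
          · exact Or.inl (by simp)
          · exact Or.inr (congrArg _ (Fin.ext (by simpa using h)))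
      · refine ⟨_, _, s.isEdge_iff.2 ⟨⟨0, hk⟩, rfl, rfl⟩, fun j hj => ?_⟩
        obtain ⟨w, rfl⟩ := hV j hj
        exact absurd ⟨w, hj⟩ hu0
    obtain ⟨j, ⟨hjp, hjq⟩, hj0⟩ :=
      mem_ideal_span_X_image.1 (mem_edgeIdeal_of_mem_radical he hf) u hu
    rcases hpq j hj0 with h | h
    · exact hjp h
    · exact hjq h
  · refine Ideal.span_le.2 ?_
    rintro _ (⟨j, hj, rfl⟩ | ⟨v, w, hvw, rfl⟩)
    · refine ⟨2, ?_⟩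
      rw [pow_two]
      exact IsForbidden.X_mul_X_mem (Or.inr (Or.inr ⟨hj, hj⟩))
    · refine Ideal.le_radical (IsForbidden.X_mul_X_mem
        (Or.inl ⟨s.i ⟨v + 1, by omega⟩, ⟨_, rfl⟩, s.strictMono ?_, s.strictMono ?_⟩))
      · exact Fin.lt_def.2 (by simp)
      · exact Fin.lt_def.2 (by simp; omega)

end BreakSeq

/-- The vertices are the indices of the variables that are not nilpotent modulo the ideal. -/
theorem X_mem_radical_vertexIdeal_iff {d : ℕ} {K : Type*} [Field K] {V : Set (Fin (d + 1))}
    {j : Fin (d + 1)} : (X j : MvPolynomial (Fin (d + 1)) K) ∈ (vertexIdeal K V).radical ↔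
      j ∉ V := by
  constructor
  · rintro ⟨n, hn⟩ hj
    rw [X_pow_eq_monomial, monomial_mem_vertexIdeal_iff] at hn
    obtain ⟨a, b, hab, hle⟩ := hn
    have h1 : ∀ c, c ≠ j →
        ¬ Finsupp.single c 1 ≤ (Finsupp.single j n : Fin (d + 1) →₀ ℕ) := fun c hc h => by
      simp [Finsupp.single_le_iff, Finsupp.single_eq_of_ne hc] at h
    obtain rfl : a = j := by
      by_contra hne
      exact h1 a hne (le_self_add.trans hle)
    obtain rfl : b = a := by
      by_contra hne
      exact h1 b hne (le_add_self.trans hle)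
    rcases hab with ⟨i, -, h2, h3⟩ | ⟨i, -, h2, h3⟩ | ⟨h2, -⟩
    · exact absurd (h2.trans h3) (lt_irrefl _)
    · exact absurd (h2.trans h3) (lt_irrefl _)
    · exact h2 hj
  · intro hj
    refine ⟨2, ?_⟩
    rw [pow_two]
    exact IsForbidden.X_mul_X_mem (Or.inr (Or.inr ⟨hj, hj⟩))

/-! ### Cohen-Macaulay rings from finite flat extensions -/

section Flat

open RingTheory.Sequence

open scoped Pointwise

theorem height_le_height_under_of_isIntegral {A R : Type*} [CommRing A] [CommRing R] [Algebra A R]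
    [Algebra.IsIntegral A R] (p : Ideal R) [p.IsPrime] : p.height ≤ (p.under A).height := by
  have hmono : StrictMono (PrimeSpectrum.comap (algebraMap A R)) := by
    intro x y hxy
    obtain ⟨r, hy, hx⟩ := SetLike.exists_of_lt ((PrimeSpectrum.asIdeal_lt_asIdeal x y).2 hxy)
    exact Ideal.comap_lt_comap_of_integral_mem_sdiff
      ((PrimeSpectrum.asIdeal_le_asIdeal x y).2 hxy.le) ⟨hy, hx⟩ (Algebra.IsIntegral.isIntegral r)
  have h := Order.height_le_height_apply_of_strictMono _ hmono ⟨p, inferInstance⟩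
  rw [← PrimeSpectrum.height_eq_orderHeight, ← PrimeSpectrum.height_eq_orderHeight] at h
  exact h

/-- An integral flat extension of a ring in which each prime contains a regular sequence of length
its height is Cohen-Macaulay: regular sequences stay regular, and heights do not increase. -/
theorem isCohenMacaulayRing_of_flat_of_isIntegral {A R : Type*} [CommRing A] [CommRing R]
    [Algebra A R] [Algebra.IsIntegral A R] [Module.Flat A R] [IsNoetherianRing R]
    (hA : ∀ q : Ideal A, q.IsPrime → ∃ rs : List A, (∀ x ∈ rs, x ∈ q) ∧ IsWeaklyRegular A rs ∧
      q.height ≤ rs.length) :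
    IsCohenMacaulayRing R := by
  refine ⟨inferInstance, fun p hp => ?_⟩
  obtain ⟨rs, hmem, hreg, hht⟩ := hA (p.under A) inferInstance
  have hmem' : ∀ x ∈ rs.map (algebraMap A R), x ∈ p := by
    intro x hx
    obtain ⟨y, hy, rfl⟩ := List.mem_map.1 hx
    exact hmem y hy
  have hregR : IsWeaklyRegular R (rs.map (algebraMap A R)) := hreg.of_flat
  have hregp := hregR.isRegular_of_isLocalization_of_mem (Localization.AtPrime p) p hmem'
  refine ⟨_, ?_, hregp, le_antisymm ?_ ?_⟩
  · intro x hx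
    obtain ⟨y, hy, rfl⟩ := List.mem_map.1 hx
    exact (IsLocalization.AtPrime.to_map_mem_maximal_iff _ p y).2 (hmem' y hy)
  · rw [← ringKrullDim_add_length_eq_ringKrullDim_of_isRegular _ hregp]
    have : Nontrivial (Localization.AtPrime p ⧸ Ideal.ofList
        ((rs.map (algebraMap A R)).map (algebraMap R (Localization.AtPrime p)))) := by
      refine Ideal.Quotient.nontrivial_iff.2 fun h => hregp.top_ne_smul ?_
      rw [h, Submodule.top_smul]
    exact le_add_of_nonneg_left ringKrullDim_nonneg_of_nontrivial
  · rw [IsLocalization.AtPrime.ringKrullDim_eq_height p]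
    simp only [List.length_map]
    exact_mod_cast (height_le_height_under_of_isIntegral (A := A) p).trans hht

/-- In a factorial ring of dimension two, each prime contains a regular sequence of length its
height: a prime element, and any second element outside the ideal it generates. -/
theorem exists_isWeaklyRegular_of_ringKrullDim_le_two {A : Type*} [CommRing A] [IsDomain A]
    [UniqueFactorizationMonoid A] [IsNoetherianRing A] (hA : ringKrullDim A ≤ 2) (q : Ideal A)
    (hq : q.IsPrime) :
    ∃ rs : List A, (∀ x ∈ rs, x ∈ q) ∧ IsWeaklyRegular A rs ∧ q.height ≤ rs.length := by
  by_cases h0 : q = ⊥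
  · exact ⟨[], by simp, IsWeaklyRegular.nil A A, by simp [h0]⟩
  · obtain ⟨f, hfq, hf⟩ := hq.exists_mem_prime_of_ne_bot h0
    have hreg : IsSMulRegular A f := fun x y h => mul_left_cancel₀ hf.ne_zero h
    by_cases h1 : q = Ideal.span {f}
    · refine ⟨[f], by simpa using hfq, (isWeaklyRegular_singleton_iff A f).2 hreg, ?_⟩
      have := Ideal.height_le_one_of_isPrincipal_of_mem_minimalPrimes (Ideal.span {f}) q
        (h1 ▸ Ideal.minimalPrimes_eq_subsingleton_self.ge rfl)
      simpa using this
    · have hlt : ¬ q ≤ Ideal.span {f} := fun h =>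
        h1 (le_antisymm h ((Ideal.span_singleton_le_iff_mem q).2 hfq))
      obtain ⟨g, hgq, hg⟩ := SetLike.not_le_iff_exists.1 hlt
      refine ⟨[f, g], by simp [hfq, hgq], ?_, ?_⟩
      · refine IsWeaklyRegular.cons hreg ((isWeaklyRegular_singleton_iff _ g).2 ?_)
        have : (Ideal.span {f}).IsPrime := (Ideal.span_singleton_prime hf.ne_zero).2 hf
        have heq : f • (⊤ : Submodule A A) = Ideal.span {f} := by
          rw [← Submodule.ideal_span_singleton_smul]
          simp
        change IsSMulRegular (A ⧸ f • (⊤ : Submodule A A)) g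
        rw [isSMulRegular_quotient_iff_mem_of_smul_mem, heq]
        intro x hx
        exact (this.mem_or_mem hx).resolve_left hg
      · have := (Ideal.height_le_ringKrullDim_of_ne_top hq.ne_top).trans hA
        rw [List.length_cons, List.length_singleton]
        exact WithBot.coe_le_coe.1 this

end Flat

/-! ### The quotient by the ideal of a set of vertices is Cohen-Macaulay -/

namespace BreakSeq

variable {d : ℕ} (s : BreakSeq d) (K : Type*) [Field K]

/-- The parity of the position of a member of the sequence. -/
def parity (j : Fin (s.k + 1)) : Fin 2 := Fin.ofNat 2 j

theorem parity_eq_iff {j l : Fin (s.k + 1)} :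
    s.parity j = s.parity l ↔ (j : ℕ) % 2 = (l : ℕ) % 2 := by
  simp [parity, Fin.ext_iff]

/-- The quotient of the polynomial ring by the ideal of the sequence. -/
def QuotRing : Type _ := MvPolynomial (Fin (d + 1)) K ⧸ vertexIdeal K s.vertices

noncomputable instance : CommRing (s.QuotRing K) :=
  inferInstanceAs (CommRing (MvPolynomial (Fin (d + 1)) K ⧸ vertexIdeal K s.vertices))

noncomputable instance : Algebra K (s.QuotRing K) :=
  inferInstanceAs (Algebra K (MvPolynomial (Fin (d + 1)) K ⧸ vertexIdeal K s.vertices))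

/-- The quotient map. -/
noncomputable def proj : MvPolynomial (Fin (d + 1)) K →ₐ[K] s.QuotRing K :=
  Ideal.Quotient.mkₐ K (vertexIdeal K s.vertices)

theorem proj_surjective : Function.Surjective (s.proj K) := Ideal.Quotient.mk_surjective

theorem proj_eq_zero_iff {f : MvPolynomial (Fin (d + 1)) K} :
    s.proj K f = 0 ↔ f ∈ vertexIdeal K s.vertices := Ideal.Quotient.eq_zero_iff_mem

/-- The class of the variable `t_j`. -/
noncomputable def coord (j : Fin (d + 1)) : s.QuotRing K := s.proj K (X j)

/-- The two parameters: the sum of the vertices at even positions and the sum of the vertices at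
odd positions. On each edge, they restrict to the two ends. -/
noncomputable def param (ε : Fin 2) : s.QuotRing K :=
  ∑ j ∈ Finset.univ.filter fun j => s.parity j = ε, s.coord K (s.i j)

/-- The structure of algebra over the polynomial ring in two variables given by the parameters. -/
noncomputable instance paramAlgebra : Algebra (MvPolynomial (Fin 2) K) (s.QuotRing K) :=
  (aeval (R := K) (s.param K)).toRingHom.toAlgebra

theorem coord_mul_coord {a b : Fin (d + 1)} (h : IsForbidden s.vertices a b) :
    s.coord K a * s.coord K b = 0 := by
  rw [coord, coord, ← map_mul]
  exact (s.proj_eq_zero_iff K).2 h.X_mul_X_mem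

theorem isEdge_castSucc_succ (v : Fin s.k) :
    IsEdge s.vertices (s.i v.castSucc) (s.i v.succ) :=
  s.isEdge_iff.2 ⟨v, rfl, rfl⟩

/-- Vertices whose positions differ by at least two form a forbidden pair. -/
theorem isForbidden_of_add_two_le {v w : Fin (s.k + 1)} (h : (v : ℕ) + 2 ≤ w) :
    IsForbidden s.vertices (s.i v) (s.i w) :=
  Or.inl ⟨s.i ⟨v + 1, by omega⟩, ⟨_, rfl⟩, s.strictMono (Fin.lt_def.2 (by simp)),
    s.strictMono (Fin.lt_def.2 (by simp; omega))⟩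

/-- A vertex and an interior point of an edge form a forbidden pair unless the vertex is an end
of the edge. -/
theorem isForbidden_of_interior {v : Fin s.k} {c : Fin (d + 1)} (h1 : s.i v.castSucc < c)
    (h2 : c < s.i v.succ) {j : Fin (s.k + 1)} (hj1 : j ≠ v.castSucc) (hj2 : j ≠ v.succ) :
    IsForbidden s.vertices c (s.i j) := by
  rcases lt_or_gt_of_ne hj1 with h | h
  · exact Or.inr (Or.inl ⟨_, ⟨v.castSucc, rfl⟩, s.strictMono h, h1⟩)
  · refine Or.inl ⟨_, ⟨v.succ, rfl⟩, h2, s.strictMono ?_⟩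
    rw [Fin.lt_def] at h ⊢
    have := Fin.val_ne_of_ne hj2
    simp at h this ⊢
    omega

/-! ### Generators over the parameters -/

section Span

variable {K}

theorem coord_mul_param_of_unique {a : Fin (d + 1)} {j : Fin (s.k + 1)}
    (h : ∀ l, s.parity l = s.parity j → l ≠ j → IsForbidden s.vertices a (s.i l)) :
    s.coord K a * s.param K (s.parity j) = s.coord K a * s.coord K (s.i j) := by
  rw [param, Finset.mul_sum]
  refine Finset.sum_eq_single_of_mem j (by simp) fun l hl hlj => ?_
  exact s.coord_mul_coord K (h l (by simpa using hl) hlj)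

theorem coord_mul_param_of_interior {v : Fin s.k} {c : Fin (d + 1)} (h1 : s.i v.castSucc < c)
    (h2 : c < s.i v.succ) {j : Fin (s.k + 1)} (hj : j = v.castSucc ∨ j = v.succ) :
    s.coord K c * s.param K (s.parity j) = s.coord K c * s.coord K (s.i j) := by
  refine s.coord_mul_param_of_unique fun l hl hlj => ?_
  rw [parity_eq_iff] at hl
  refine s.isForbidden_of_interior h1 h2 ?_ ?_
  · rintro rfl
    rcases hj with rfl | rfl
    · exact hlj rfl
    · simp at hl; omega
  · rintro rfl
    rcases hj with rfl | rfl
    · simp at hl; omega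
    · exact hlj rfl

theorem coord_mul_param_parity (j : Fin (s.k + 1)) :
    s.coord K (s.i j) * s.param K (s.parity j) = s.coord K (s.i j) * s.coord K (s.i j) := by
  refine s.coord_mul_param_of_unique fun l hl hlj => ?_
  rw [parity_eq_iff] at hl
  have := Fin.val_ne_of_ne hlj
  rcases lt_or_gt_of_ne hlj with h | h
  · exact (s.isForbidden_of_add_two_le (by omega)).symm
  · exact s.isForbidden_of_add_two_le (by omega)

theorem coord_last_mul_param (v : Fin s.k) (hv : (v : ℕ) + 1 = s.k) :
    s.coord K (s.i v.succ) * s.param K (s.parity v.castSucc) =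
      s.coord K (s.i v.succ) * s.coord K (s.i v.castSucc) := by
  refine s.coord_mul_param_of_unique fun l hl hlj => ?_
  rw [parity_eq_iff] at hl
  have := Fin.val_ne_of_ne hlj
  refine (s.isForbidden_of_add_two_le ?_).symm
  simp at hl this ⊢
  omega

theorem coord_mul_param_neighbours (v w : Fin s.k) (hv : (w : ℕ) = v + 1) :
    s.coord K (s.i v.succ) * s.param K (s.parity v.castSucc) =
      s.coord K (s.i v.succ) * s.coord K (s.i v.castSucc) +
        s.coord K (s.i v.succ) * s.coord K (s.i w.succ) := by
  rw [param, Finset.mul_sum]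
  have hne : v.castSucc ≠ w.succ := fun h => by
    have := congrArg Fin.val h
    simp at this
    omega
  refine Finset.sum_eq_add_of_mem _ _ (by simp) ?_ hne fun l hl hlj => ?_
  · simp [parity_eq_iff]
    omega
  · simp only [Finset.mem_filter, Finset.mem_univ, true_and, parity_eq_iff] at hl
    have h1 := Fin.val_ne_of_ne hlj.1
    have h2 := Fin.val_ne_of_ne hlj.2
    simp only [Fin.val_castSucc, Fin.val_succ] at hl h1 h2
    refine s.coord_mul_coord K ?_
    rcases lt_or_ge (l : ℕ) v with h | h
    · exact (s.isForbidden_of_add_two_le (by simp; omega)).symm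
    · exact s.isForbidden_of_add_two_le (by simp; omega)

theorem X_smul (ε : Fin 2) (x : s.QuotRing K) :
    (X ε : MvPolynomial (Fin 2) K) • x = x * s.param K ε := by
  rw [Algebra.smul_def, mul_comm]
  congr 1
  exact aeval_X _ _

theorem C_smul_one (r : K) :
    (C r : MvPolynomial (Fin 2) K) • (1 : s.QuotRing K) = s.proj K (C r) := by
  rw [Algebra.smul_def, mul_one]
  exact (aeval_C _ _).trans ((s.proj K).commutes r).symm

/-- A submodule over the parameters that contains `1` and all `t_j` contains all products
`t_a t_b`. -/
theorem coord_mul_coord_mem (hd : 1 ≤ d) {N : Submodule (MvPolynomial (Fin 2) K) (s.QuotRing K)}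
    (hN : ∀ j, s.coord K j ∈ N) (a b : Fin (d + 1)) : s.coord K a * s.coord K b ∈ N := by
  -- products of the ends of an edge, by descending induction along the edges
  have hedge : ∀ n, ∀ v : Fin s.k, (v : ℕ) + 1 + n = s.k →
      s.coord K (s.i v.succ) * s.coord K (s.i v.castSucc) ∈ N := by
    intro n
    induction n with
    | zero =>
      intro v hv
      rw [← s.coord_last_mul_param v hv, ← s.X_smul]
      exact N.smul_mem _ (hN _)
    | succ n ih =>
      intro v hv
      have h := s.coord_mul_param_neighbours (K := K) v ⟨v + 1, by omega⟩ rfl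
      have h' := ih ⟨v + 1, by omega⟩ (by simp; omega)
      rw [eq_sub_of_add_eq h.symm, ← s.X_smul]
      refine N.sub_mem (N.smul_mem _ (hN _)) ?_
      rw [mul_comm]
      exact h'
  have hvert : ∀ v : Fin s.k, ∀ j l, (j = v.castSucc ∨ j = v.succ) →
      (l = v.castSucc ∨ l = v.succ) → s.coord K (s.i j) * s.coord K (s.i l) ∈ N := by
    have hsq : ∀ j, s.coord K (s.i j) * s.coord K (s.i j) ∈ N := fun j => by
      rw [← s.coord_mul_param_parity, ← s.X_smul]
      exact N.smul_mem _ (hN _)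
    have hv : ∀ v : Fin s.k, s.coord K (s.i v.succ) * s.coord K (s.i v.castSucc) ∈ N :=
      fun v => hedge (s.k - (v + 1)) v (by omega)
    rintro v j l (rfl | rfl) (rfl | rfl)
    · exact hsq _
    · rw [mul_comm]
      exact hv v
    · exact hv v
    · exact hsq _
  have hint : ∀ (v : Fin s.k) (c : Fin (d + 1)) (j : Fin (s.k + 1)), s.i v.castSucc ≤ c →
      c ≤ s.i v.succ → (j = v.castSucc ∨ j = v.succ) → s.coord K c * s.coord K (s.i j) ∈ N := by
    intro v c j h1 h2 hj
    rcases h1.eq_or_lt with h1 | h1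
    · exact h1 ▸ hvert v _ _ (Or.inl rfl) hj
    rcases h2.eq_or_lt with h2 | h2
    · exact h2 ▸ hvert v _ _ (Or.inr rfl) hj
    rw [← s.coord_mul_param_of_interior h1 h2 hj, ← s.X_smul]
    exact N.smul_mem _ (hN _)
  by_cases hab : IsForbidden s.vertices a b
  · rw [s.coord_mul_coord K hab]
    exact N.zero_mem
  · obtain ⟨p, q, he, h1, h2, h3, h4, h5⟩ :=
      (not_isForbidden_iff hd s.zero_mem_vertices s.last_mem_vertices).1 hab
    obtain ⟨v, rfl, rfl⟩ := s.isEdge_iff.1 he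
    rcases h5 with rfl | rfl | rfl | rfl
    · rw [mul_comm]
      exact hint v _ _ h3 h4 (Or.inl rfl)
    · rw [mul_comm]
      exact hint v _ _ h3 h4 (Or.inr rfl)
    · exact hint v _ _ h1 h2 (Or.inl rfl)
    · exact hint v _ _ h1 h2 (Or.inr rfl)

/-- The position of the second member of the sequence. -/
def second (hd : 1 ≤ d) : Fin (s.k + 1) := ⟨1, by have := s.k_pos hd; omega⟩

variable (K) in
/-- The generators over the parameters, once the index `i_1` is left out: `1` in place of `t_0`,
and `t_j` for the other indices. -/
noncomputable def gen (j : Fin (d + 1)) : s.QuotRing K := if j = 0 then 1 else s.coord K j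

theorem span_gen (hd : 1 ≤ d) :
    Submodule.span (MvPolynomial (Fin 2) K)
      (Set.range fun l => s.gen K ((s.i (s.second hd)).succAbove l)) = ⊤ := by
  set N := Submodule.span (MvPolynomial (Fin 2) K)
    (Set.range fun l => s.gen K ((s.i (s.second hd)).succAbove l)) with hNdef
  have hgen : ∀ j, j ≠ s.i (s.second hd) → s.gen K j ∈ N := by
    intro j hj
    obtain ⟨l, rfl⟩ := Fin.exists_succAbove_eq hj
    exact Submodule.subset_span ⟨l, rfl⟩
  have hsec : s.i (s.second hd) ≠ 0 := by
    rw [← s.first]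
    exact s.strictMono.injective.ne (by simp [second, Fin.ext_iff])
  have h1 : (1 : s.QuotRing K) ∈ N := by
    simpa [gen] using hgen 0 hsec.symm
  have hcoord : ∀ j, j ≠ s.i (s.second hd) → j ≠ 0 → s.coord K j ∈ N := by
    intro j hj hj0
    simpa [gen, hj0] using hgen j hj
  -- `t_0` and `t_{i_1}` are recovered from the two parameters
  have hfirst : ∀ j : Fin (s.k + 1), (j : ℕ) ≤ 1 → s.coord K (s.i j) ∈ N := by
    intro j hj
    have hp : s.param K (s.parity j) ∈ N := by
      rw [← one_mul (s.param K _), ← s.X_smul]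
      exact N.smul_mem _ h1
    rw [param, ← Finset.add_sum_erase _ _ (by simp : j ∈ _)] at hp
    refine (N.add_mem_iff_left (N.sum_mem fun l hl => ?_)).1 hp
    simp only [Finset.mem_erase, Finset.mem_filter, Finset.mem_univ, true_and, parity_eq_iff] at hl
    have hlj := Fin.val_ne_of_ne hl.1
    refine hcoord _ (s.strictMono.injective.ne ?_) ?_
    · rw [Ne, Fin.ext_iff]
      simp only [second]
      omega
    · rw [← s.first]
      refine s.strictMono.injective.ne ?_
      rw [Ne, Fin.ext_iff]
      simp only [Fin.val_zero]
      omega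
  have hall : ∀ j, s.coord K j ∈ N := by
    intro j
    by_cases hj : j = s.i (s.second hd)
    · rw [hj]
      exact hfirst _ (by simp [second])
    · by_cases hj0 : j = 0
      · rw [hj0, ← s.first]
        exact hfirst _ (by simp)
      · exact hcoord j hj hj0
  have hmul : ∀ x ∈ N, ∀ j, x * s.coord K j ∈ N := by
    intro x hx j
    induction hx using Submodule.span_induction with
    | mem x hx =>
      obtain ⟨l, rfl⟩ := hx
      simp only [gen]
      split_ifs
      · rw [one_mul]
        exact hall j
      · exact s.coord_mul_coord_mem hd hall _ _
    | zero => simp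
    | add x y _ _ hx hy =>
      rw [add_mul]
      exact N.add_mem hx hy
    | smul r x _ hx =>
      rw [smul_mul_assoc]
      exact N.smul_mem _ hx
  rw [eq_top_iff]
  rintro x -
  obtain ⟨f, rfl⟩ := s.proj_surjective K x
  induction f using MvPolynomial.induction_on with
  | C r =>
    rw [← s.C_smul_one]
    exact N.smul_mem _ h1
  | add f g hf hg =>
    rw [map_add]
    exact N.add_mem hf hg
  | mul_X f j hf =>
    rw [map_mul]
    exact hmul _ hf j

end Span

end BreakSeq

namespace BreakSeq

variable {d : ℕ} (s : BreakSeq d) {K : Type*} [Field K]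

/-! ### Independence of the generators over the parameters -/

section Independence

open scoped Classical in
/-- The image of the variable `t_j` under the map that restricts to an edge and its first order
neighbourhood in the direction of `t_c`. -/
noncomputable def edgeValue (K : Type*) [Field K] (v : Fin s.k) (c j : Fin (d + 1)) :
    TrivSqZeroExt (MvPolynomial (Fin 2) K) (MvPolynomial (Fin 2) K) :=
  if j = s.i v.castSucc then .inl (X (s.parity v.castSucc))
  else if j = s.i v.succ then .inl (X (s.parity v.succ))
  else if j = c then .inr 1 else 0

variable {v : Fin s.k} {c : Fin (d + 1)}

theorem i_castSucc_ne_succ (v : Fin s.k) : s.i v.castSucc ≠ s.i v.succ :=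
  (s.isEdge_castSucc_succ v).lt.ne

theorem edgeValue_castSucc (v : Fin s.k) (c : Fin (d + 1)) :
    s.edgeValue K v c (s.i v.castSucc) = .inl (X (s.parity v.castSucc)) := if_pos rfl

theorem edgeValue_succ (v : Fin s.k) (c : Fin (d + 1)) :
    s.edgeValue K v c (s.i v.succ) = .inl (X (s.parity v.succ)) := by
  rw [edgeValue, if_neg (s.i_castSucc_ne_succ v).symm, if_pos rfl]

theorem edgeValue_mul_edgeValue (h1 : s.i v.castSucc ≤ c) (h2 : c ≤ s.i v.succ)
    {a b : Fin (d + 1)} (hab : IsForbidden s.vertices a b) :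
    s.edgeValue K v c a * s.edgeValue K v c b = 0 := by
  -- the two indices are not both in the edge with one of them at an end
  have key : ∀ {a b : Fin (d + 1)}, IsForbidden s.vertices a b →
      (a = s.i v.castSucc ∨ a = s.i v.succ) →
      ¬ (s.i v.castSucc ≤ b ∧ b ≤ s.i v.succ) := by
    rintro a b hab ha ⟨hb1, hb2⟩
    have he := s.isEdge_castSucc_succ v
    have hlt := he.lt
    rcases hab with ⟨i, hi, h3, h4⟩ | ⟨i, hi, h3, h4⟩ | ⟨h3, -⟩
    · have := he.le_or_le i hi
      rcases ha with rfl | rfl <;> omega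
    · have := he.le_or_le i hi
      rcases ha with rfl | rfl <;> omega
    · rcases ha with rfl | rfl
      · exact h3 he.left
      · exact h3 he.right
  have hval : ∀ {b : Fin (d + 1)}, ¬ (s.i v.castSucc ≤ b ∧ b ≤ s.i v.succ) →
      s.edgeValue K v c b = 0 := by
    intro b hb
    have hlt := (s.isEdge_castSucc_succ v).lt
    rw [edgeValue, if_neg, if_neg, if_neg]
    · rintro rfl; exact hb ⟨h1, h2⟩
    · rintro rfl; exact hb ⟨hlt.le, le_rfl⟩
    · rintro rfl; exact hb ⟨le_rfl, hlt.le⟩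
  by_cases ha : a = s.i v.castSucc ∨ a = s.i v.succ
  · rw [hval (key hab ha), mul_zero]
  · by_cases hb : b = s.i v.castSucc ∨ b = s.i v.succ
    · rw [hval (key hab.symm hb), zero_mul]
    · push Not at ha hb
      rw [edgeValue, edgeValue, if_neg ha.1, if_neg ha.2, if_neg hb.1, if_neg hb.2]
      split_ifs <;> simp

/-- The map of the quotient ring given by `edgeValue`. -/
noncomputable def edgeMap (K : Type*) [Field K] (h1 : s.i v.castSucc ≤ c) (h2 : c ≤ s.i v.succ) :
    s.QuotRing K →ₐ[K] TrivSqZeroExt (MvPolynomial (Fin 2) K) (MvPolynomial (Fin 2) K) :=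
  Ideal.Quotient.liftₐ (vertexIdeal K s.vertices) (aeval (s.edgeValue K v c)) <| by
    have : vertexIdeal K s.vertices ≤ RingHom.ker (aeval (R := K) (s.edgeValue K v c)) := by
      refine vertexIdeal_le_iff.2 fun a b hab => ?_
      rw [RingHom.mem_ker, map_mul, aeval_X, aeval_X]
      exact s.edgeValue_mul_edgeValue h1 h2 hab
    exact fun f hf => this hf

theorem edgeMap_coord (h1 : s.i v.castSucc ≤ c) (h2 : c ≤ s.i v.succ) (j : Fin (d + 1)) :
    s.edgeMap K h1 h2 (s.coord K j) = s.edgeValue K v c j := by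
  refine (Ideal.Quotient.liftₐ_apply _ _ _ _).trans ?_
  exact aeval_X _ _

theorem edgeMap_param (h1 : s.i v.castSucc ≤ c) (h2 : c ≤ s.i v.succ) (ε : Fin 2) :
    s.edgeMap K h1 h2 (s.param K ε) = .inl (X ε) := by
  have hvtx : ∀ j, j ≠ v.castSucc → j ≠ v.succ → s.edgeValue K v c (s.i j) = 0 := by
    intro j hj1 hj2
    have hj := (s.isEdge_castSucc_succ v).le_or_le _ ⟨j, rfl⟩
    have hne1 := s.strictMono.injective.ne hj1
    have hne2 := s.strictMono.injective.ne hj2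
    rw [edgeValue, if_neg hne1, if_neg hne2, if_neg]
    rintro rfl
    rcases hj with hj | hj
    · exact hne1 (le_antisymm hj h1)
    · exact hne2 (le_antisymm h2 hj)
  rw [param, map_sum]
  simp only [edgeMap_coord]
  have hpar : s.parity v.castSucc ≠ s.parity v.succ := by
    rw [Ne, parity_eq_iff]
    simp
    omega
  have hε : ε = s.parity v.castSucc ∨ ε = s.parity v.succ := by omega
  rcases hε with rfl | rfl
  · rw [Finset.sum_eq_single_of_mem v.castSucc (by simp), edgeValue_castSucc]
    intro j hj hne
    refine hvtx j hne ?_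
    rintro rfl
    exact hpar (Finset.mem_filter.1 hj).2.symm
  · rw [Finset.sum_eq_single_of_mem v.succ (by simp), edgeValue_succ]
    intro j hj hne
    refine hvtx j ?_ hne
    rintro rfl
    exact hpar (by simpa using hj)

theorem edgeMap_smul (h1 : s.i v.castSucc ≤ c) (h2 : c ≤ s.i v.succ)
    (r : MvPolynomial (Fin 2) K) (x : s.QuotRing K) :
    s.edgeMap K h1 h2 (r • x) = r • s.edgeMap K h1 h2 x := by
  have h : ((s.edgeMap K h1 h2).comp (aeval (s.param K))) =
      TrivSqZeroExt.inlAlgHom K (MvPolynomial (Fin 2) K) (MvPolynomial (Fin 2) K) := by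
    refine algHom_ext fun ε => ?_
    rw [AlgHom.comp_apply, aeval_X, edgeMap_param]
    rfl
  have h' := DFunLike.congr_fun h r
  rw [Algebra.smul_def, map_mul]
  refine (congrArg (· * _) h').trans ?_
  exact TrivSqZeroExt.inl_mul_eq_smul r _

/-- A relation between the generators is trivial: the neighbourhoods of the edges detect the
coefficients of the `t_j` that are not vertices, and then the edges, from left to right, detect
those of the vertices. -/
theorem eq_zero_of_sum_smul_gen_eq_zero (hd : 1 ≤ d) (g : Fin (d + 1) → MvPolynomial (Fin 2) K)
    (hg : g (s.i (s.second hd)) = 0) (h : ∑ j, g j • s.gen K j = 0) (j : Fin (d + 1)) :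
    g j = 0 := by
  have hrel : ∀ {v : Fin s.k} {c : Fin (d + 1)} (h1 : s.i v.castSucc ≤ c) (h2 : c ≤ s.i v.succ),
      ∑ j, g j • s.edgeMap K h1 h2 (s.gen K j) = 0 := by
    intro v c h1 h2
    simpa [edgeMap_smul] using congrArg (s.edgeMap K h1 h2) h
  have hgen : ∀ {v : Fin s.k} {c : Fin (d + 1)} (h1 : s.i v.castSucc ≤ c) (h2 : c ≤ s.i v.succ)
      (j : Fin (d + 1)), s.edgeMap K h1 h2 (s.gen K j) =
        if j = 0 then 1 else s.edgeValue K v c j := by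
    intro v c h1 h2 j
    rw [gen]
    split_ifs
    · exact map_one _
    · exact s.edgeMap_coord h1 h2 j
  -- the coefficients of the indices that are not vertices
  have hint : ∀ c, c ∉ s.vertices → g c = 0 := by
    intro c hc
    have hc0 : c ≠ 0 := by rintro rfl; exact hc s.zero_mem_vertices
    obtain ⟨p, q, he, h1, h2⟩ := exists_isEdge_lt_le s.zero_mem_vertices s.last_mem_vertices
      (Fin.pos_iff_ne_zero.2 hc0)
    obtain ⟨v, rfl, rfl⟩ := s.isEdge_iff.1 he
    have h3 := congrArg TrivSqZeroExt.snd (hrel h1.le h2)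
    rw [TrivSqZeroExt.snd_sum, Finset.sum_eq_single_of_mem c (Finset.mem_univ _)] at h3
    · have hne : c ≠ s.i v.succ := by rintro rfl; exact hc he.right
      simpa [hgen, hc0, edgeValue, h1.ne', hne] using h3
    · intro j _ hjc
      rw [hgen, edgeValue]
      split_ifs <;> simp
  have hcoef : ∀ v : Fin s.k, g 0 + ((if v.castSucc = 0 then 0 else
      g (s.i v.castSucc) * X (s.parity v.castSucc)) +
        g (s.i v.succ) * X (s.parity v.succ)) = 0 := by
    intro v
    have hlt := (s.isEdge_castSucc_succ v).lt
    have h3 := congrArg TrivSqZeroExt.fst (hrel le_rfl hlt.le)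
    have hs0 : s.i v.succ ≠ 0 := ((Fin.zero_le _).trans_lt hlt).ne'
    have hterm : ∀ j, (g j • s.edgeMap K le_rfl hlt.le (s.gen K j)).fst =
        (if j = 0 then g 0 else 0) + ((if j = s.i v.castSucc then (if v.castSucc = 0 then 0 else
          g (s.i v.castSucc) * X (s.parity v.castSucc)) else 0) +
          (if j = s.i v.succ then g (s.i v.succ) * X (s.parity v.succ) else 0)) := by
      intro j
      have hv0 : v.castSucc = 0 ↔ s.i v.castSucc = 0 := by
        rw [← s.first]
        exact s.strictMono.injective.eq_iff.symm
      rw [hgen, edgeValue]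
      by_cases hj0 : j = 0
      · subst hj0
        simp only [if_true, TrivSqZeroExt.fst_smul, TrivSqZeroExt.fst_one, smul_eq_mul, mul_one,
          if_neg hs0.symm, add_zero]
        by_cases h4 : s.i v.castSucc = 0
        · rw [if_pos (hv0.2 h4)]
          simp
        · rw [if_neg (Ne.symm h4), add_zero]
      · rw [if_neg hj0, if_neg hj0, zero_add]
        by_cases h4 : j = s.i v.castSucc
        · subst h4
          rw [if_pos rfl, if_pos rfl, if_neg hlt.ne, if_neg (mt hv0.1 hj0), add_zero]
          simp
        · by_cases h5 : j = s.i v.succ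
          · subst h5
            simp [hlt.ne']
          · simp [h4, h5]
    rw [TrivSqZeroExt.fst_sum, Finset.sum_congr rfl fun j _ => hterm j, Finset.sum_add_distrib,
      Finset.sum_add_distrib] at h3
    simpa using h3
  have h0 : g 0 = 0 := by
    have h4 := hcoef ⟨0, s.k_pos hd⟩
    have h5 : s.i (⟨0, s.k_pos hd⟩ : Fin s.k).succ = s.i (s.second hd) := by
      congr 1
    rw [if_pos (by rfl), h5, hg] at h4
    simpa using h4
  have hvert : ∀ n (hn : n < s.k + 1), g (s.i ⟨n, hn⟩) = 0 := by
    intro n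
    induction n with
    | zero =>
      intro hn
      have : s.i ⟨0, hn⟩ = 0 := s.first
      rw [this, h0]
    | succ n ih =>
      intro hn
      have h4 := hcoef ⟨n, by omega⟩
      have h5 : g (s.i (⟨n, by omega⟩ : Fin s.k).castSucc) = 0 := ih (by omega)
      rw [h0, h5] at h4
      simpa using h4
  by_cases hj : j ∈ s.vertices
  · obtain ⟨l, rfl⟩ := hj
    exact hvert l l.2
  · exact hint j hj

theorem linearIndependent_gen (hd : 1 ≤ d) :
    LinearIndependent (MvPolynomial (Fin 2) K)
      fun l => s.gen K ((s.i (s.second hd)).succAbove l) := by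
  rw [Fintype.linearIndependent_iff]
  intro g hg l
  have h := s.eq_zero_of_sum_smul_gen_eq_zero (K := K) hd
    (Fin.insertNth (α := fun _ => MvPolynomial (Fin 2) K) (s.i (s.second hd)) 0 g)
    (Fin.insertNth_apply_same _ _ _) ?_ ((s.i (s.second hd)).succAbove l)
  · rwa [Fin.insertNth_apply_succAbove] at h
  · rw [Fin.sum_univ_succAbove _ (s.i (s.second hd)), Fin.insertNth_apply_same, zero_smul, zero_add]
    simpa only [Fin.insertNth_apply_succAbove] using hg

end Independence

variable (K) in
/-- The quotient is Cohen-Macaulay, being free of rank `d` over the polynomial ring generated by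
the two parameters. -/
theorem isCohenMacaulayRing_quotient (hd : 1 ≤ d) :
    IsCohenMacaulayRing (MvPolynomial (Fin (d + 1)) K ⧸ vertexIdeal K s.vertices) := by
  let b := Module.Basis.mk (s.linearIndependent_gen (K := K) hd) (s.span_gen hd).ge
  have hfree : Module.Free (MvPolynomial (Fin 2) K) (s.QuotRing K) := Module.Free.of_basis b
  have hfin : Module.Finite (MvPolynomial (Fin 2) K) (s.QuotRing K) := Module.Finite.of_basis b
  have hnoeth : IsNoetherianRing (s.QuotRing K) :=
    inferInstanceAs (IsNoetherianRing (MvPolynomial (Fin (d + 1)) K ⧸ vertexIdeal K s.vertices))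
  have hdim : ringKrullDim (MvPolynomial (Fin 2) K) ≤ 2 := by
    rw [MvPolynomial.ringKrullDim_of_isNoetherianRing]
    simp
  exact isCohenMacaulayRing_of_flat_of_isIntegral (R := s.QuotRing K)
    (exists_isWeaklyRegular_of_ringKrullDim_le_two hdim)

end BreakSeq

/-! ### Cohen-Macaulay rings have no embedded primes -/

/-- If `S ⧸ I` is Cohen-Macaulay, the annihilator of a nonzero element of `S ⧸ I` is contained in a
minimal prime of `I`: at an associated prime the depth is zero, hence so is the dimension. -/
theorem IsCohenMacaulayRing.exists_mem_minimalPrimes {S : Type*} [CommRing S] {I : Ideal S}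
    (h : IsCohenMacaulayRing (S ⧸ I)) {u : S} (hu : u ∉ I) :
    ∃ Q ∈ I.minimalPrimes, ∀ x, x * u ∈ I → x ∈ Q := by
  obtain ⟨hnoeth, hcm⟩ := h
  obtain ⟨P, hP, hle⟩ := exists_le_isAssociatedPrime_of_isNoetherianRing (S ⧸ I)
    (Ideal.Quotient.mk I u) (mt Ideal.Quotient.eq_zero_iff_mem.1 hu)
  obtain ⟨hprime, y, hy⟩ := isAssociatedPrime_iff.1 hP
  have hmem : ∀ a, a ∈ P ↔ a * y = 0 := fun a => by
    rw [hy, Submodule.mem_colon_singleton, Submodule.mem_bot, smul_eq_mul]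
  obtain ⟨rs, hrs, hreg, hlen⟩ := hcm P
  have hnil : rs = [] := by
    rcases rs with _ | ⟨r, rs⟩
    · rfl
    · exfalso
      have hr := ((RingTheory.Sequence.isRegular_cons_iff _ _ _).1 hreg).1
      have hrm := hrs r (List.mem_cons_self ..)
      obtain ⟨a, t, rfl⟩ := IsLocalization.exists_mk'_eq P.primeCompl r
      have ha : a ∈ P := (IsLocalization.AtPrime.mk'_mem_maximal_iff _ P a t).1 hrm
      have h0 : algebraMap (S ⧸ I) (Localization.AtPrime P) y = 0 := by
        refine hr ?_
        simp only [smul_eq_mul]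
        rw [mul_zero, IsLocalization.mk'_eq_mul_mk'_one, mul_right_comm, ← map_mul,
          (hmem a).1 ha, map_zero, zero_mul]
      obtain ⟨c, hc⟩ := (IsLocalization.map_eq_zero_iff P.primeCompl _ y).1 h0
      exact c.2 ((hmem _).2 hc)
  have hht : P.height = 0 := by
    rw [hnil, IsLocalization.AtPrime.ringKrullDim_eq_height P] at hlen
    simpa using hlen.symm
  refine ⟨P.comap (Ideal.Quotient.mk I), ?_, fun x hx => ?_⟩
  · rw [Ideal.minimalPrimes_eq_comap]
    exact ⟨P, Ideal.height_eq_zero_iff.1 hht, rfl⟩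
  · refine hle ?_
    rw [Submodule.mem_colon_singleton, Submodule.mem_bot, smul_eq_mul, ← map_mul]
    exact Ideal.Quotient.eq_zero_iff_mem.2 hx

/-! ### Standard monomials -/

section StandardSet

variable {d : ℕ}

theorem indexSum_eq_sum (u : Fin (d + 1) →₀ ℕ) : indexSum d u = ∑ j, u j * (j : ℕ) := by
  rw [indexSum, Finsupp.weight_apply, Finsupp.sum_fintype _ _ (by simp)]
  simp

/-- A monomial of degree one is a variable. -/
theorem exists_eq_single_of_degree_eq_one {σ : Type*} {u : σ →₀ ℕ} (h : u.degree = 1) :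
    ∃ a, u = Finsupp.single a 1 := by
  have h0 : u ≠ 0 := by rintro rfl; simp at h
  obtain ⟨a, ha⟩ := Finsupp.support_nonempty_iff.2 h0
  obtain ⟨r, rfl⟩ := exists_add_of_le
    (Finsupp.single_le_iff.2 (Nat.one_le_iff_ne_zero.2 (Finsupp.mem_support_iff.1 ha)))
  have hr : r = 0 := by
    rw [← Finsupp.degree_eq_zero_iff]
    simpa using h
  exact ⟨a, by rw [hr, add_zero]⟩

theorem exists_eq_single_add_single_of_degree_eq_two {σ : Type*} {u : σ →₀ ℕ} (h : u.degree = 2) :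
    ∃ a b, u = Finsupp.single a 1 + Finsupp.single b 1 := by
  have h0 : u ≠ 0 := by rintro rfl; simp at h
  obtain ⟨a, ha⟩ := Finsupp.support_nonempty_iff.2 h0
  obtain ⟨r, rfl⟩ := exists_add_of_le
    (Finsupp.single_le_iff.2 (Nat.one_le_iff_ne_zero.2 (Finsupp.mem_support_iff.1 ha)))
  obtain ⟨b, rfl⟩ := exists_eq_single_of_degree_eq_one (u := r) (by
    simp only [map_add, Finsupp.degree_single] at h
    omega)
  exact ⟨a, b, rfl⟩

/-- A set of monomials closed under divisors that contains exactly one monomial of each fibre, such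
as the monomials outside an initial ideal of the curve ideal. -/
structure IsStandardSet (Std : (Fin (d + 1) →₀ ℕ) → Prop) : Prop where
  mono : ∀ {u v}, u ≤ v → Std v → Std u
  exists_mem : ∀ u, ∃ v, curveExponent d v = curveExponent d u ∧ Std v
  unique : ∀ {u v}, curveExponent d u = curveExponent d v → Std u → Std v → u = v

/-- The variables all of whose powers are standard. -/
def powerVertices (Std : (Fin (d + 1) →₀ ℕ) → Prop) : Set (Fin (d + 1)) :=
  {j | ∀ n, Std (Finsupp.single j n)}

/-- The monomials that stay standard when multiplied by powers of `t_p` and `t_q`. -/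
def IsStable (Std : (Fin (d + 1) →₀ ℕ) → Prop) (p q : Fin (d + 1)) (u : Fin (d + 1) →₀ ℕ) : Prop :=
  ∀ n, Std (u + (Finsupp.single p n + Finsupp.single q n))

namespace IsStandardSet

variable {Std : (Fin (d + 1) →₀ ℕ) → Prop}

theorem zero_mem_powerVertices (hS : IsStandardSet Std) (hd : 1 ≤ d) : 0 ∈ powerVertices Std := by
  intro n
  obtain ⟨v, hv, hstd⟩ := hS.exists_mem (Finsupp.single 0 n)
  obtain ⟨hdeg, hsum⟩ := (curveExponent_eq_iff hd).1 hv
  rw [indexSum_single, Fin.val_zero, mul_zero, indexSum_eq_sum, Finset.sum_eq_zero_iff] at hsum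
  have hv0 : v = Finsupp.single 0 (v 0) := by
    ext j
    by_cases hj : j = 0
    · rw [hj, Finsupp.single_eq_same]
    · rw [Finsupp.single_eq_of_ne hj]
      exact (Nat.mul_eq_zero.1 (hsum j (Finset.mem_univ _))).resolve_right
        fun h => hj (Fin.ext h)
  rw [hv0, Finsupp.degree_single, Finsupp.degree_single] at hdeg
  rw [← hdeg, ← hv0]
  exact hstd

theorem last_mem_powerVertices (hS : IsStandardSet Std) (hd : 1 ≤ d) :
    Fin.last d ∈ powerVertices Std := by
  intro n
  obtain ⟨v, hv, hstd⟩ := hS.exists_mem (Finsupp.single (Fin.last d) n)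
  obtain ⟨hdeg, hsum⟩ := (curveExponent_eq_iff hd).1 hv
  rw [Finsupp.degree_single] at hdeg
  rw [indexSum_single, Fin.val_last, ← hdeg, indexSum_eq_sum, Finsupp.degree_eq_sum,
    Finset.sum_mul] at hsum
  have hle : ∀ j ∈ Finset.univ, v j * (j : ℕ) ≤ v j * d := fun j _ =>
    Nat.mul_le_mul_left _ j.is_le
  have hall := (Finset.sum_eq_sum_iff_of_le hle).1 hsum
  have hv0 : v = Finsupp.single (Fin.last d) (v (Fin.last d)) := by
    ext j
    by_cases hj : j = Fin.last d
    · rw [hj, Finsupp.single_eq_same]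
    · rw [Finsupp.single_eq_of_ne hj]
      by_contra h0
      exact hj (Fin.ext (Nat.eq_of_mul_eq_mul_left (Nat.pos_of_ne_zero h0)
        (hall j (Finset.mem_univ _))))
  rw [hv0, Finsupp.degree_single] at hdeg
  rw [← hdeg, ← hv0]
  exact hstd

theorem single_mem (hS : IsStandardSet Std) (hd : 1 ≤ d) (j : Fin (d + 1)) : Std
    (Finsupp.single j 1) := by
  obtain ⟨v, hv, hstd⟩ := hS.exists_mem (Finsupp.single j 1)
  obtain ⟨hdeg, hsum⟩ := (curveExponent_eq_iff hd).1 hv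
  obtain ⟨a, rfl⟩ := exists_eq_single_of_degree_eq_one (hdeg.trans (by simp))
  obtain rfl : a = j := Fin.ext (by simpa using hsum)
  exact hstd

/-- High powers of two vertices that are not neighbours have a product that is not standard. -/
theorem not_mem_of_lt_of_lt (hS : IsStandardSet Std) (hd : 1 ≤ d) {p r q : Fin (d + 1)}
    (hr : r ∈ powerVertices Std)
    (hpr : p < r) (hrq : r < q) {N : ℕ} (hN : d ≤ N) :
    ¬ Std (Finsupp.single p N + Finsupp.single q N) := by
  intro h
  rw [Fin.lt_def] at hpr hrq
  have hq := q.is_le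
  have h1 : Std (Finsupp.single p ((q : ℕ) - r) + Finsupp.single q ((r : ℕ) - p)) :=
    hS.mono (add_le_add (Finsupp.single_le_single.2 (by omega))
      (Finsupp.single_le_single.2 (by omega))) h
  have h2 := hS.unique (v := Finsupp.single r ((q : ℕ) - p)) ?_ h1 (hr _)
  · have h3 := DFunLike.congr_fun h2 r
    rw [Finsupp.add_apply, Finsupp.single_eq_same,
      Finsupp.single_eq_of_ne (by rintro rfl; omega),
      Finsupp.single_eq_of_ne (by rintro rfl; omega)] at h3
    omega
  · rw [curveExponent_eq_iff hd]
    obtain ⟨x, hx⟩ := Nat.exists_eq_add_of_lt hpr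
    obtain ⟨y, hy⟩ := Nat.exists_eq_add_of_lt hrq
    have e1 : (q : ℕ) - r = y + 1 := by omega
    have e2 : (r : ℕ) - p = x + 1 := by omega
    have e3 : (q : ℕ) - p = x + y + 2 := by omega
    simp only [map_add, Finsupp.degree_single, indexSum_single, e1, e2, e3]
    refine ⟨by ring, ?_⟩
    rw [hy, hx]
    ring

/-- All products of powers of the ends of an edge are standard: the standard monomial in the fibre
of a high power of `t_p t_q` must involve high powers of vertices on both sides of the midpoint,
and these can only be `p` and `q`. -/
theorem isStable_zero (hS : IsStandardSet Std) (hd : 1 ≤ d) {p q : Fin (d + 1)}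
    (he : IsEdge (powerVertices Std) p q) :
    IsStable Std p q 0 := by
  have hbound : ∃ N₀, ∀ j ∉ powerVertices Std, ¬ Std (Finsupp.single j N₀) := by
    have : ∀ j, ∃ n, j ∉ powerVertices Std → ¬ Std (Finsupp.single j n) := by
      intro j
      by_cases hj : j ∈ powerVertices Std
      · exact ⟨0, fun h => absurd hj h⟩
      · rw [powerVertices, Set.mem_ofPred_eq, not_forall] at hj
        obtain ⟨n, hn⟩ := hj
        exact ⟨n, fun _ => hn⟩
    choose f hf using this
    refine ⟨Finset.univ.sup f, fun j hj h => hf j hj (hS.mono ?_ h)⟩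
    exact Finsupp.single_le_single.2 (Finset.le_sup (Finset.mem_univ j))
  obtain ⟨N₀, hN₀⟩ := hbound
  intro n
  rw [zero_add]
  set N := n + N₀ + d with hN
  suffices h : Std (Finsupp.single p N + Finsupp.single q N) from
    hS.mono (add_le_add (Finsupp.single_le_single.2 (by omega))
      (Finsupp.single_le_single.2 (by omega))) h
  set M := (d + 1) * (N * d) + 1 with hM
  obtain ⟨u, hu, hstd⟩ := hS.exists_mem (Finsupp.single p M + Finsupp.single q M)
  obtain ⟨hdeg, hsum⟩ := (curveExponent_eq_iff hd).1 hu
  simp only [map_add, Finsupp.degree_single, indexSum_single] at hdeg hsum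
  rw [Finsupp.degree_eq_sum] at hdeg
  rw [indexSum_eq_sum] at hsum
  have hvert : ∀ j, N ≤ u j → j ∈ powerVertices Std := by
    intro j hj
    by_contra hjV
    refine hN₀ j hjV (hS.mono ?_ hstd)
    rw [Finsupp.single_le_iff]
    omega
  have hlt := Fin.lt_def.1 he.lt
  obtain ⟨x, hx⟩ := Nat.exists_eq_add_of_lt hlt
  have hright : ∃ j, q ≤ j ∧ N ≤ u j := by
    by_contra! hcon
    have hle : ∀ j ∈ Finset.univ, u j * (j : ℕ) ≤ u j * p + N * d := by
      intro j _
      rcases le_or_gt j p with h | h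
      · exact (Nat.mul_le_mul_left _ h).trans (Nat.le_add_right _ _)
      · have huj : u j ≤ N := by
          by_contra! hNj
          rcases he.le_or_le j (hvert j hNj.le) with h' | h'
          · omega
          · have := hcon j h'
            omega
        exact (Nat.mul_le_mul huj j.is_le).trans (Nat.le_add_left _ _)
    have h := Finset.sum_le_sum hle
    rw [hsum, Finset.sum_add_distrib, ← Finset.sum_mul, hdeg, Finset.sum_const, Finset.card_univ,
      Fintype.card_fin, smul_eq_mul, hx] at h
    have e : M * (p : ℕ) + M * (p + x + 1) = (M + M) * p + M * x + M := by ring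
    omega
  have hleft : ∃ j, j ≤ p ∧ N ≤ u j := by
    by_contra! hcon
    have hle : ∀ j ∈ Finset.univ, u j * (q : ℕ) ≤ u j * j + N * d := by
      intro j _
      rcases le_or_gt q j with h | h
      · exact (Nat.mul_le_mul_left _ h).trans (Nat.le_add_right _ _)
      · have huj : u j ≤ N := by
          by_contra! hNj
          rcases he.le_or_le j (hvert j hNj.le) with h' | h'
          · have := hcon j h'
            omega
          · omega
        exact (Nat.mul_le_mul huj q.is_le).trans (Nat.le_add_left _ _)
    have h := Finset.sum_le_sum hle
    rw [Finset.sum_add_distrib, ← Finset.sum_mul, hdeg, hsum, Finset.sum_const, Finset.card_univ,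
      Fintype.card_fin, smul_eq_mul, hx] at h
    have e : (M + M) * ((p : ℕ) + x + 1) = M * p + M * (p + x + 1) + M * x + M := by ring
    omega
  obtain ⟨b, hqb, hb⟩ := hright
  obtain ⟨a, hap, ha⟩ := hleft
  have hab : a < b := hap.trans_lt (he.lt.trans_le hqb)
  have hstd' : Std (Finsupp.single a N + Finsupp.single b N) := by
    refine hS.mono (fun j => ?_) hstd
    rw [Finsupp.add_apply, Finsupp.single_apply, Finsupp.single_apply]
    split_ifs with h1 h2 h2
    · exact absurd (h1.trans h2.symm) hab.ne
    · subst h1; omega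
    · subst h2; omega
    · omega
  obtain rfl : q = b := by
    by_contra hne
    exact hS.not_mem_of_lt_of_lt hd he.right (hap.trans_lt he.lt)
      (lt_of_le_of_ne hqb hne) (by omega) hstd'
  obtain rfl : a = p := by
    by_contra hne
    exact hS.not_mem_of_lt_of_lt hd he.left (lt_of_le_of_ne hap hne) he.lt (by omega) hstd'
  exact hstd'

theorem isStable_single (hS : IsStandardSet Std) (hd : 1 ≤ d) {p q : Fin (d + 1)}
    (he : IsEdge (powerVertices Std) p q) :
    IsStable Std p q (Finsupp.single p 1) := fun n => by
  refine hS.mono ?_ (hS.isStable_zero hd he (n + 1))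
  rw [zero_add, ← add_assoc, ← Finsupp.single_add, add_comm 1 n]
  exact add_le_add le_rfl (Finsupp.single_le_single.2 (by omega))

/-- Up to the ends of the edge, a stable monomial is determined by the sum of its indices, counted
from `p`, modulo the length of the edge. -/
theorem eq_of_isStable (hS : IsStandardSet Std) (hd : 1 ≤ d) {p q : Fin (d + 1)}
    {u v : Fin (d + 1) →₀ ℕ}
    (hu : IsStable Std p q u) (hv : IsStable Std p q v)
    (huv : ((q : ℤ) - p) ∣ ((indexSum d v : ℤ) - p * v.degree) - (indexSum d u - p * u.degree))
    {j : Fin (d + 1)} (hjp : j ≠ p) (hjq : j ≠ q) : u j = v j := by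
  obtain ⟨t, ht⟩ := huv
  -- multiplying by powers of `t_p` and `t_q` moves both monomials into the same fibre
  set r : ℤ := v.degree - u.degree - t with hr
  have hstd : ∀ {w : Fin (d + 1) →₀ ℕ}, IsStable Std p q w → ∀ m n,
      Std (w + (Finsupp.single p m + Finsupp.single q n)) := fun {w} hw m n =>
    hS.mono (add_le_add le_rfl (add_le_add (Finsupp.single_le_single.2 (le_max_left m n))
      (Finsupp.single_le_single.2 (le_max_right m n)))) (hw (max m n))
  have h := hS.unique ?_ (hstd hu r.toNat t.toNat) (hstd hv (-r).toNat (-t).toNat)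
  · have h' := DFunLike.congr_fun h j
    simpa [Finsupp.single_eq_of_ne hjp, Finsupp.single_eq_of_ne hjq] using h'
  · have h1 := Int.toNat_sub_toNat_neg r
    have h2 := Int.toNat_sub_toNat_neg t
    rw [curveExponent_eq_iff hd]
    simp only [map_add, Finsupp.degree_single, indexSum_single]
    constructor
    · zify
      linarith
    · zify
      have h3 : (r.toNat : ℤ) = (-r).toNat + r := by linarith
      have h4 : (t.toNat : ℤ) = (-t).toNat + t := by linarith
      rw [h3, h4, hr]
      linear_combination -ht

end IsStandardSet

end StandardSet

section Unmixed

variable {d : ℕ} {Std : (Fin (d + 1) →₀ ℕ) → Prop}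

/-! ### Standard monomials without embedded components -/

/-- Every standard monomial is stable for some edge, that is, no associated prime of the complement
is embedded. -/
def IsUnmixed (Std : (Fin (d + 1) →₀ ℕ) → Prop) : Prop :=
  ∀ u, Std u → ∃ p q, IsEdge (powerVertices Std) p q ∧ IsStable Std p q u

open scoped Classical in
/-- The indices that are not vertices and are assigned to the edge `e`. -/
noncomputable def assigned (Std : (Fin (d + 1) →₀ ℕ) → Prop)
    (φ : Fin (d + 1) → Fin (d + 1) × Fin (d + 1)) (e : Fin (d + 1) × Fin (d + 1)) :
    Finset (Fin (d + 1)) :=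
  Finset.univ.filter fun j => j ∉ powerVertices Std ∧ φ j = e

theorem mem_assigned {φ : Fin (d + 1) → Fin (d + 1) × Fin (d + 1)}
    {e : Fin (d + 1) × Fin (d + 1)} {j : Fin (d + 1)} :
    j ∈ assigned Std φ e ↔ j ∉ powerVertices Std ∧ φ j = e := by
  simp [assigned]

/-- An assignment of each index that is not a vertex to an edge for which its variable is stable. -/
def IsAssignment (Std : (Fin (d + 1) →₀ ℕ) → Prop)
    (φ : Fin (d + 1) → Fin (d + 1) × Fin (d + 1)) : Prop :=
  ∀ j ∉ powerVertices Std, IsEdge (powerVertices Std) (φ j).1 (φ j).2 ∧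
    IsStable Std (φ j).1 (φ j).2 (Finsupp.single j 1)

variable {φ : Fin (d + 1) → Fin (d + 1) × Fin (d + 1)}

/-- The residue of an index, counted from `p`, modulo the length of the edge `(p, q)`. -/
def edgeResidue (p q j : Fin (d + 1)) : ZMod ((q : ℕ) - p) :=
  (((j : ℤ) - p : ℤ) : ZMod ((q : ℕ) - p))

namespace IsStandardSet

theorem edgeResidue_injOn (hS : IsStandardSet Std) (hd : 1 ≤ d) (hφ : IsAssignment Std φ)
    {p q : Fin (d + 1)} (he : IsEdge (powerVertices Std) p q) :
    Set.InjOn (edgeResidue p q) (insert p (assigned Std φ (p, q)) : Finset (Fin (d + 1))) := by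
  have hstable : ∀ j ∈ insert p (assigned Std φ (p, q)), IsStable Std p q (Finsupp.single j 1) := by
    intro j hj
    rcases Finset.mem_insert.1 hj with rfl | hj
    · exact hS.isStable_single hd he
    · obtain ⟨hjV, hje⟩ := mem_assigned.1 hj
      have h := (hφ j hjV).2
      rwa [hje] at h
  have hne : ∀ j ∈ assigned Std φ (p, q), j ≠ p ∧ j ≠ q := by
    intro j hj
    have hjV := (mem_assigned.1 hj).1
    constructor
    · rintro rfl; exact hjV he.left
    · rintro rfl; exact hjV he.right
  have key : ∀ j ∈ assigned Std φ (p, q), ∀ l ∈ insert p (assigned Std φ (p, q)),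
      edgeResidue p q j = edgeResidue p q l → j = l := by
    intro j hj l hl h
    have hlt := Fin.lt_def.1 he.lt
    rw [edgeResidue, edgeResidue, ZMod.intCast_eq_intCast_iff_dvd_sub,
      Nat.cast_sub hlt.le] at h
    have h' := hS.eq_of_isStable hd (hstable j (Finset.mem_insert_of_mem hj)) (hstable l hl)
      (by simpa using h) (hne j hj).1 (hne j hj).2
    by_contra hjl
    rw [Finsupp.single_eq_same, Finsupp.single_eq_of_ne hjl] at h'
    exact one_ne_zero h'
  intro j hj l hl h
  rw [Finset.mem_coe] at hj hl
  rcases Finset.mem_insert.1 hj with rfl | hj'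
  · rcases Finset.mem_insert.1 hl with rfl | hl'
    · rfl
    · exact (key l hl' _ hj h.symm).symm
  · exact key j hj' l hl h

theorem card_insert_assigned_le (hS : IsStandardSet Std) (hd : 1 ≤ d) (hφ : IsAssignment Std φ)
    {p q : Fin (d + 1)} (he : IsEdge (powerVertices Std) p q) :
    (assigned Std φ (p, q)).card + 1 ≤ (q : ℕ) - p := by
  classical
  have hlt := Fin.lt_def.1 he.lt
  have : NeZero ((q : ℕ) - p) := ⟨by omega⟩
  have hp : p ∉ assigned Std φ (p, q) := fun h => (mem_assigned.1 h).1 he.left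
  have h := Finset.card_le_card_of_injOn (edgeResidue p q) (fun _ _ => Finset.mem_univ _)
    (hS.edgeResidue_injOn hd hφ he)
  rwa [Finset.card_insert_of_notMem hp, Finset.card_univ, ZMod.card] at h

/-- As many indices are assigned to an edge as there are between its ends: there are at most so
many, and both numbers sum to the number of all indices that are not vertices. -/
theorem card_assigned (hS : IsStandardSet Std) (hd : 1 ≤ d) (hφ : IsAssignment Std φ)
    {p q : Fin (d + 1)} (he : IsEdge (powerVertices Std) p q) :
    (assigned Std φ (p, q)).card + 1 = (q : ℕ) - p := by
  classical
  have h0 := hS.zero_mem_powerVertices hd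
  have hl := hS.last_mem_powerVertices hd
  set V := powerVertices Std with hV
  have hψ : ∀ j, ∃ e : Fin (d + 1) × Fin (d + 1), j ∉ V → IsEdge V e.1 e.2 ∧ e.1 < j ∧ j < e.2 := by
    intro j
    by_cases hj : j ∈ V
    · exact ⟨(0, 0), fun h => absurd hj h⟩
    · have hj0 : j ≠ 0 := by rintro rfl; exact hj h0
      obtain ⟨p, q, he, h1, h2⟩ := exists_isEdge_lt_le h0 hl (Fin.pos_iff_ne_zero.2 hj0)
      refine ⟨(p, q), fun _ => ⟨he, h1, lt_of_le_of_ne h2 ?_⟩⟩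
      rintro rfl
      exact hj he.right
  choose ψ hψ using hψ
  set W := Finset.univ.filter fun j => j ∉ V with hW
  set E := Finset.univ.filter fun e : Fin (d + 1) × Fin (d + 1) => IsEdge V e.1 e.2 with hE
  have hcardφ : W.card = ∑ e ∈ E, (W.filter fun j => φ j = e).card :=
    Finset.card_eq_sum_card_fiberwise fun j hj => by
      simpa [hE] using (hφ j (by simpa [hW] using hj)).1
  have hcardψ : W.card = ∑ e ∈ E, (W.filter fun j => ψ j = e).card :=
    Finset.card_eq_sum_card_fiberwise fun j hj => by
      simpa [hE] using (hψ j (by simpa [hW] using hj)).1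
  have hfibφ : ∀ e, (W.filter fun j => φ j = e) = assigned Std φ e := by
    intro e
    ext j
    simp [hW, mem_assigned, hV]
  have hfibψ : ∀ e ∈ E, (W.filter fun j => ψ j = e).card + 1 = (e.2 : ℕ) - e.1 := by
    rintro ⟨p, q⟩ he
    have he : IsEdge V p q := by simpa [hE] using he
    have hIoo : (W.filter fun j => ψ j = (p, q)) = Finset.Ioo p q := by
      ext j
      simp only [hW, Finset.mem_filter, Finset.mem_univ, true_and, Finset.mem_Ioo]
      constructor
      · rintro ⟨h1, h2⟩
        have h3 := (hψ j h1).2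
        rwa [h2] at h3
      · rintro ⟨h1, h2⟩
        have hj := he.notMem h1 h2
        obtain ⟨h3, h4, h5⟩ := hψ j hj
        refine ⟨hj, ?_⟩
        have h6 := h3.le_or_le p he.left
        have h7 := h3.le_or_le q he.right
        have h8 := he.le_or_le _ h3.left
        have h9 := he.le_or_le _ h3.right
        have h10 : (ψ j).1 = p := by omega
        have h11 : (ψ j).2 = q := by omega
        exact Prod.ext h10 h11
    have hlt := Fin.lt_def.1 he.lt
    rw [hIoo, Fin.card_Ioo]
    simp only
    omega
  have hle : ∀ e ∈ E, (W.filter fun j => φ j = e).card ≤ (W.filter fun j => ψ j = e).card := by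
    rintro ⟨p, q⟩ he
    have h1 := hfibψ _ he
    have he : IsEdge V p q := by simpa [hE] using he
    have h2 := hS.card_insert_assigned_le hd hφ he
    rw [hfibφ]
    simp only at h1
    omega
  have heE : (p, q) ∈ E := by simpa [hE] using he
  have h1 := (Finset.sum_eq_sum_iff_of_le hle).1 (hcardφ.symm.trans hcardψ) (p, q) heE
  rw [← hfibφ, h1]
  exact hfibψ _ heE

/-- A stable monomial of an edge is, up to the ends of the edge, `1` or the variable of an index
assigned to the edge, since these exhaust all residues. -/
theorem exists_mem_assigned_of_isStable (hS : IsStandardSet Std) (hd : 1 ≤ d)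
    (hφ : IsAssignment Std φ) {p q : Fin (d + 1)} (he : IsEdge (powerVertices Std) p q)
    {u : Fin (d + 1) →₀ ℕ} (hu : IsStable Std p q u) :
    ∃ j, (j = p ∨ j ∈ assigned Std φ (p, q)) ∧
      ∀ i, i ≠ p → i ≠ q → u i = Finsupp.single j 1 i := by
  classical
  have hlt := Fin.lt_def.1 he.lt
  have : NeZero ((q : ℕ) - p) := ⟨by omega⟩
  have hp : p ∉ assigned Std φ (p, q) := fun h => (mem_assigned.1 h).1 he.left
  have himage : (insert p (assigned Std φ (p, q))).image (edgeResidue p q) = Finset.univ := by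
    refine Finset.eq_univ_of_card _ ?_
    rw [Finset.card_image_of_injOn (hS.edgeResidue_injOn hd hφ he),
      Finset.card_insert_of_notMem hp, hS.card_assigned hd hφ he, ZMod.card]
  obtain ⟨j, hj, hres⟩ := Finset.mem_image.1 (himage.symm ▸ Finset.mem_univ
    (((indexSum d u : ℤ) - p * u.degree : ℤ) : ZMod ((q : ℕ) - p)))
  rw [edgeResidue, ZMod.intCast_eq_intCast_iff_dvd_sub, Nat.cast_sub hlt.le] at hres
  have hjs : IsStable Std p q (Finsupp.single j 1) := by
    rcases Finset.mem_insert.1 hj with rfl | hj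
    · exact hS.isStable_single hd he
    · obtain ⟨hjV, hje⟩ := mem_assigned.1 hj
      have h := (hφ j hjV).2
      rwa [hje] at h
  refine ⟨j, Finset.mem_insert.1 hj, fun i hip hiq => ?_⟩
  exact (hS.eq_of_isStable hd hjs hu (by simpa using hres) hip hiq).symm

/-- In a standard quadric one factor is an end of an edge, and the other one is an end of this edge
or assigned to it. -/
theorem exists_isEdge_of_quadric (hS : IsStandardSet Std) (hd : 1 ≤ d) (hφ : IsAssignment Std φ)
    (hU : IsUnmixed Std) {a b : Fin (d + 1)}
    (h : Std (Finsupp.single a 1 + Finsupp.single b 1)) :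
    ∃ p q, IsEdge (powerVertices Std) p q ∧
      ((a = p ∨ a = q) ∧ (b = p ∨ b = q ∨ b ∈ assigned Std φ (p, q)) ∨
        (b = p ∨ b = q) ∧ (a = p ∨ a = q ∨ a ∈ assigned Std φ (p, q))) := by
  obtain ⟨p, q, he, hst⟩ := hU _ h
  refine ⟨p, q, he, ?_⟩
  obtain ⟨j, hj, hij⟩ := hS.exists_mem_assigned_of_isStable hd hφ he hst
  simp only [Finsupp.add_apply] at hij
  have hstep : ∀ {x y : Fin (d + 1)}, (∀ i, i ≠ p → i ≠ q → (Finsupp.single x 1 : _ →₀ ℕ) i +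
      (Finsupp.single y 1 : _ →₀ ℕ) i = (Finsupp.single j 1 : _ →₀ ℕ) i) →
      x ≠ p → x ≠ q → x = j ∧ x ≠ y := by
    intro x y hxy h1 h2
    have h3 := hxy x h1 h2
    rw [Finsupp.single_eq_same] at h3
    by_cases hxj : x = j
    · refine ⟨hxj, fun hxy' => ?_⟩
      rw [← hxj, ← hxy', Finsupp.single_eq_same] at h3
      omega
    · rw [Finsupp.single_eq_of_ne hxj] at h3
      omega
  have hij' : ∀ i, i ≠ p → i ≠ q → (Finsupp.single b 1 : _ →₀ ℕ) i +
      (Finsupp.single a 1 : _ →₀ ℕ) i = (Finsupp.single j 1 : _ →₀ ℕ) i := fun i h1 h2 => by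
    rw [add_comm, hij i h1 h2]
  by_cases ha : a = p ∨ a = q
  · by_cases hb : b = p ∨ b = q
    · tauto
    · push Not at hb
      obtain ⟨rfl, -⟩ := hstep hij' hb.1 hb.2
      tauto
  · push Not at ha
    obtain ⟨rfl, hab⟩ := hstep hij ha.1 ha.2
    by_cases hb : b = p ∨ b = q
    · tauto
    · push Not at hb
      exact absurd (hstep hij' hb.1 hb.2).1.symm hab

/-- The indices between the ends of an edge are assigned to it, by induction on the edges from left
to right: for `p < j < q`, the standard quadric in the fibre of `t_p t_j` can only be `t_p t_j`. -/
theorem assigned_eq_Ioo (hS : IsStandardSet Std) (hd : 1 ≤ d) (hφ : IsAssignment Std φ)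
    (hU : IsUnmixed Std) {p q : Fin (d + 1)} (he : IsEdge (powerVertices Std) p q) :
    assigned Std φ (p, q) = Finset.Ioo p q := by
  induction p using WellFoundedLT.induction generalizing q with
  | ind p ih =>
  have h0 := hS.zero_mem_powerVertices hd
  have hl := hS.last_mem_powerVertices hd
  symm
  refine Finset.eq_of_subset_of_card_le (fun j hj => ?_) ?_
  swap
  · have h1 := hS.card_assigned hd hφ he
    have hlt := Fin.lt_def.1 he.lt
    rw [Fin.card_Ioo]
    omega
  obtain ⟨hpj, hjq⟩ := Finset.mem_Ioo.1 hj
  rw [Fin.lt_def] at hpj hjq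
  have hjV : j ∉ powerVertices Std := he.notMem hpj hjq
  obtain ⟨v, hv, hstd⟩ := hS.exists_mem (Finsupp.single p 1 + Finsupp.single j 1)
  obtain ⟨hdeg, hsum⟩ := (curveExponent_eq_iff hd).1 hv
  obtain ⟨a, b, rfl⟩ := exists_eq_single_add_single_of_degree_eq_two (hdeg.trans (by simp))
  simp only [map_add, indexSum_single, one_mul] at hsum
  obtain ⟨p', q', he', hab⟩ := hS.exists_isEdge_of_quadric hd hφ hU hstd
  have hlt' := Fin.lt_def.1 he'.lt
  rcases lt_or_ge p' p with hpp | hpp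
  · -- an edge further left only contains quadrics whose sum of indices is at most `2 p`
    have hqp := Fin.le_def.1 (he'.right_le_left he hpp)
    have hle : ∀ i, (i = p' ∨ i = q' ∨ i ∈ assigned Std φ (p', q')) → (i : ℕ) ≤ p := by
      rintro i (rfl | rfl | hi)
      · omega
      · omega
      · rw [ih p' hpp he', Finset.mem_Ioo, Fin.lt_def, Fin.lt_def] at hi
        omega
    have ha := hle a (by tauto)
    have hb := hle b (by tauto)
    omega
  · have hge : ∀ i, (i = p' ∨ i = q' ∨ i ∈ assigned Std φ (p', q')) → (p : ℕ) ≤ i := by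
      rw [Fin.le_def] at hpp
      rintro i (rfl | rfl | hi)
      · omega
      · omega
      · by_contra! hip
        obtain ⟨hiV, hie⟩ := mem_assigned.1 hi
        have hi0 : i ≠ 0 := by rintro rfl; exact hiV h0
        obtain ⟨p'', q'', he'', h1, h2⟩ := exists_isEdge_lt_le h0 hl (Fin.pos_iff_ne_zero.2 hi0)
        have hiq : i ≠ q'' := by rintro rfl; exact hiV he''.right
        have h3 : i ∈ assigned Std φ (p'', q'') := by
          rw [ih p'' (h1.trans hip) he'']
          exact Finset.mem_Ioo.2 ⟨h1, lt_of_le_of_ne h2 hiq⟩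
        have h4 := (mem_assigned.1 h3).2
        rw [hie] at h4
        have h5 := congrArg Prod.fst h4
        simp only at h5
        omega
    have hend : ∀ {x y : Fin (d + 1)}, (x = p' ∨ x = q') →
        (y = p' ∨ y = q' ∨ y ∈ assigned Std φ (p', q')) → (x : ℕ) + y = p + j →
        j ∈ assigned Std φ (p, q) := by
      intro x y hx hy hxy
      have hy' := hge y hy
      have hx' := hge x (by tauto)
      have hxV : x ∈ powerVertices Std := by
        rcases hx with rfl | rfl
        · exact he'.left
        · exact he'.right
      have hxp : x = p := by
        have := he.le_or_le x hxV
        omega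
      have hyj : y = j := Fin.ext (by rw [hxp] at hxy; omega)
      have hp' : p' = p := by
        rw [Fin.le_def] at hpp
        rcases hx with rfl | rfl
        · exact hxp
        · rw [hxp] at hlt'
          omega
      subst hp'
      obtain rfl := he.eq_right he'
      subst hyj
      rcases hy with rfl | rfl | hy
      · exact absurd he'.left hjV
      · exact absurd he'.right hjV
      · exact hy
    rcases hab with ⟨h1, h2⟩ | ⟨h1, h2⟩
    · exact hend h1 h2 hsum
    · exact hend h1 h2 (by omega)

/-- A standard set without embedded components contains no forbidden quadric. -/
theorem not_isForbidden_of_isUnmixed (hS : IsStandardSet Std) (hd : 1 ≤ d) (hU : IsUnmixed Std)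
    {a b : Fin (d + 1)} (h : Std (Finsupp.single a 1 + Finsupp.single b 1)) :
    ¬ IsForbidden (powerVertices Std) a b := by
  have hex : ∀ j, ∃ e : Fin (d + 1) × Fin (d + 1),
      IsEdge (powerVertices Std) e.1 e.2 ∧ IsStable Std e.1 e.2 (Finsupp.single j 1) := by
    intro j
    obtain ⟨p, q, he, hst⟩ := hU _ (hS.single_mem hd j)
    exact ⟨(p, q), he, hst⟩
  choose φ hφ using hex
  have hφ' : IsAssignment Std φ := fun j _ => hφ j
  obtain ⟨p, q, he, hab⟩ := hS.exists_isEdge_of_quadric hd hφ' hU h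
  rw [hS.assigned_eq_Ioo hd hφ' hU he, Finset.mem_Ioo, Finset.mem_Ioo] at hab
  rw [not_isForbidden_iff hd (hS.zero_mem_powerVertices hd) (hS.last_mem_powerVertices hd)]
  have hlt := he.lt
  refine ⟨p, q, he, ?_⟩
  omega

end IsStandardSet

end Unmixed

section CohenMacaulayInitial

variable {d : ℕ} {K : Type*} [Field K]

/-! ### Cohen-Macaulay initial ideals -/

theorem isStandardSet_initialIdeal_curve (m : MonomialOrder (Fin (d + 1))) :
    IsStandardSet fun u => monomial u (1 : K) ∉ initialIdeal m (rationalNormalCurveIdeal K d) where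
  mono := by
    intro u v huv hv hu
    obtain ⟨w, rfl⟩ := exists_add_of_le huv
    refine hv ?_
    rw [← one_mul (1 : K), ← monomial_mul]
    exact Ideal.mul_mem_right _ _ hu
  exists_mem := exists_monomial_notMem_initialIdeal_curve m
  unique := fun h hu hv => eq_of_notMem_initialIdeal_curve m h hu hv

/-- The prime ideal of the variables other than `t_p` and `t_q` contains the initial ideal if all
products of powers of `t_p` and `t_q` are standard. -/
theorem initialIdeal_curve_le_span_X (m : MonomialOrder (Fin (d + 1))) {p q : Fin (d + 1)}
    (h : IsStable (fun u => monomial u (1 : K) ∉ initialIdeal m (rationalNormalCurveIdeal K d))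
      p q 0) :
    initialIdeal m (rationalNormalCurveIdeal K d) ≤
      Ideal.span (X '' {j | j ≠ p ∧ j ≠ q}) := by
  intro f hf
  rw [mem_ideal_span_X_image]
  intro u hu
  by_contra! hcon
  have huI := (monomial_mem_initialIdeal_curve_iff (K := K) m u).2
    ((mem_initialIdeal_curve_iff m f).1 hf u hu)
  refine (isStandardSet_initialIdeal_curve (K := K) m).mono (fun j => ?_) (h (u p + u q)) huI
  by_cases hj : j ≠ p ∧ j ≠ q
  · rw [hcon j hj]
    exact Nat.zero_le _
  · rw [zero_add, Finsupp.add_apply]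
    rcases not_and_or.1 hj with hj | hj <;> rw [not_not] at hj <;> subst hj <;>
      rw [Finsupp.single_eq_same] <;> omega

/-- Each minimal prime of the initial ideal is generated by the variables away from an edge. -/
theorem exists_isEdge_of_mem_minimalPrimes (m : MonomialOrder (Fin (d + 1))) (hd : 1 ≤ d)
    {Q : Ideal (MvPolynomial (Fin (d + 1)) K)}
    (hQ : Q ∈ (initialIdeal m (rationalNormalCurveIdeal K d)).minimalPrimes) :
    ∃ p q, IsEdge (powerVertices fun u =>
        monomial u (1 : K) ∉ initialIdeal m (rationalNormalCurveIdeal K d)) p q ∧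
      Q = Ideal.span (X '' {j | j ≠ p ∧ j ≠ q}) := by
  classical
  have hS := isStandardSet_initialIdeal_curve (K := K) m
  have h0 := hS.zero_mem_powerVertices hd
  have hl := hS.last_mem_powerVertices hd
  have hprime := hQ.1.1
  have hIQ := hQ.1.2
  set I := initialIdeal m (rationalNormalCurveIdeal K d) with hI
  set V := powerVertices fun u => monomial u (1 : K) ∉ I with hV
  have hpow : ∀ j n, monomial (Finsupp.single j n) (1 : K) ∈ Q → X j ∈ Q := by
    intro j n h
    rw [← X_pow_eq_monomial] at h
    exact hprime.mem_of_pow_mem _ h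
  have hvert : ∀ j, X j ∉ Q → j ∈ V := fun j hj n hn => hj (hpow j n (hIQ hn))
  have hedge : ∀ a b r, X a ∉ Q → X b ∉ Q → a < r → r < b → r ∉ V := by
    intro a b r ha hb har hrb hr
    have h := not_not.1 (hS.not_mem_of_lt_of_lt hd hr har hrb le_rfl)
    have h' := hIQ h
    rw [← one_mul (1 : K), ← monomial_mul] at h'
    rcases hprime.mem_or_mem h' with h' | h'
    · exact ha (hpow a d h')
    · exact hb (hpow b d h')
  -- the variables outside `Q` belong to the two ends of an edge
  obtain ⟨p, q, he, hsub⟩ : ∃ p q, IsEdge V p q ∧ ∀ j, X j ∉ Q → j = p ∨ j = q := by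
    by_cases hex : ∃ a, X a ∉ Q ∧ a ≠ Fin.last d
    · set F := Finset.univ.filter fun j : Fin (d + 1) => X j ∉ Q with hF
      have hFne : F.Nonempty := by
        obtain ⟨a, ha, -⟩ := hex
        exact ⟨a, by simpa [hF] using ha⟩
      have hmemF : ∀ {j}, j ∈ F ↔ X j ∉ Q := by simp [hF]
      have hmin := hmemF.1 (F.min'_mem hFne)
      have hminlt : F.min' hFne < Fin.last d := by
        obtain ⟨a, ha, hal⟩ := hex
        exact (F.min'_le a (hmemF.2 ha)).trans_lt (Fin.lt_last_iff_ne_last.2 hal)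
      obtain ⟨p, q, he, h1, h2⟩ := exists_isEdge_le_lt h0 hl hminlt
      have hp : F.min' hFne = p := by
        rcases he.le_or_le _ (hvert _ hmin) with h | h
        · exact le_antisymm h h1
        · exact absurd h2 (not_lt.2 h)
      refine ⟨p, q, he, fun j hj => ?_⟩
      have hpj : p ≤ j := hp ▸ F.min'_le j (hmemF.2 hj)
      rcases he.le_or_le j (hvert j hj) with h | h
      · exact Or.inl (le_antisymm h hpj)
      · right
        by_contra hne
        exact hedge p j q (hp ▸ hmin) hj he.lt (lt_of_le_of_ne h (Ne.symm hne)) he.right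
    · push Not at hex
      have hlast : (0 : Fin (d + 1)) < Fin.last d := Fin.pos_iff_ne_zero.2 (by
        intro h
        have := congrArg Fin.val h
        simp at this
        omega)
      obtain ⟨p, q, he, h1, h2⟩ := exists_isEdge_lt_le h0 hl hlast
      refine ⟨p, q, he, fun j hj => Or.inr ?_⟩
      rw [hex j hj]
      exact (le_antisymm (Fin.le_last q) h2).symm
  refine ⟨p, q, he, le_antisymm ?_ ?_⟩
  · refine hQ.2 ⟨isPrime_span_X_image _, initialIdeal_curve_le_span_X m (hS.isStable_zero hd he)⟩
      (Ideal.span_le.2 ?_)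
    rintro _ ⟨j, hj, rfl⟩
    by_contra hjQ
    rcases hsub j hjQ with h | h
    · exact hj.1 h
    · exact hj.2 h
  · refine Ideal.span_le.2 ?_
    rintro _ ⟨j, hj, rfl⟩
    by_contra hjQ
    rcases hsub j hjQ with h | h
    · exact hj.1 h
    · exact hj.2 h

theorem isUnmixed_of_isCohenMacaulayRing (m : MonomialOrder (Fin (d + 1))) (hd : 1 ≤ d)
    (hcm : IsCohenMacaulayRing
      (MvPolynomial (Fin (d + 1)) K ⧸ initialIdeal m (rationalNormalCurveIdeal K d))) :
    IsUnmixed fun u => monomial u (1 : K) ∉ initialIdeal m (rationalNormalCurveIdeal K d) := by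
  intro u hu
  obtain ⟨Q, hQ, hann⟩ := hcm.exists_mem_minimalPrimes hu
  obtain ⟨p, q, he, rfl⟩ := exists_isEdge_of_mem_minimalPrimes m hd hQ
  refine ⟨p, q, he, fun n hn => ?_⟩
  rw [← one_mul (1 : K), add_comm u, ← monomial_mul] at hn
  have h := hann _ hn
  classical
  rw [mem_ideal_span_X_image] at h
  obtain ⟨j, ⟨hjp, hjq⟩, hj⟩ := h (Finsupp.single p n + Finsupp.single q n) (by simp)
  rw [Finsupp.add_apply, Finsupp.single_eq_of_ne hjp, Finsupp.single_eq_of_ne hjq] at hj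
  exact hj rfl

/-- A Cohen-Macaulay initial ideal of the curve ideal is the ideal of forbidden products for the set
of the variables all of whose powers are standard. -/
theorem initialIdeal_curve_eq_of_isCohenMacaulayRing (m : MonomialOrder (Fin (d + 1)))
    (hd : 1 ≤ d) (hcm : IsCohenMacaulayRing
      (MvPolynomial (Fin (d + 1)) K ⧸ initialIdeal m (rationalNormalCurveIdeal K d))) :
    ∃ V : Set (Fin (d + 1)), 0 ∈ V ∧ Fin.last d ∈ V ∧
      initialIdeal m (rationalNormalCurveIdeal K d) = vertexIdeal K V := by
  have hS := isStandardSet_initialIdeal_curve (K := K) m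
  have h0 := hS.zero_mem_powerVertices hd
  have hl := hS.last_mem_powerVertices hd
  refine ⟨_, h0, hl, initialIdeal_curve_eq_vertexIdeal hd h0 hl (vertexIdeal_le_iff.2 ?_)⟩
  intro a b hab
  by_contra h
  rw [← single_add_single_eq_X_mul_X] at h
  exact hS.not_isForbidden_of_isUnmixed hd (isUnmixed_of_isCohenMacaulayRing m hd hcm) h hab

end CohenMacaulayInitial

section Classification

variable {d : ℕ} {K : Type*} [Field K]

/-! ### Counting -/

/-- The ideals of two sets of vertices have the same radical only if the sets agree. -/
theorem eq_of_radical_vertexIdeal_eq {V W : Set (Fin (d + 1))}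
    (h : (vertexIdeal K V).radical = (vertexIdeal K W).radical) : V = W := by
  ext j
  rw [← not_iff_not, ← X_mem_radical_vertexIdeal_iff (K := K), h, X_mem_radical_vertexIdeal_iff]

namespace BreakSeq

theorem vertices_injective : Function.Injective (vertices : BreakSeq d → Set (Fin (d + 1))) := by
  rintro ⟨k, i, hi, h0, hl⟩ ⟨k', i', hi', h0', hl'⟩ h
  have h : Set.range i = Set.range i' := h
  obtain rfl : k = k' := by
    have h1 := congrArg Set.ncard h
    rw [Set.ncard_range_of_injective hi.injective, Set.ncard_range_of_injective hi'.injective] at h1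
    simpa using h1
  obtain rfl := (hi.range_inj hi').1 h
  rfl

theorem exists_vertices_eq {V : Set (Fin (d + 1))} (h0 : 0 ∈ V) (hl : Fin.last d ∈ V) :
    ∃ s : BreakSeq d, s.vertices = V := by
  classical
  set F := V.toFinset with hF
  have h0F : 0 ∈ F := Set.mem_toFinset.2 h0
  have hlF : Fin.last d ∈ F := Set.mem_toFinset.2 hl
  have hne : F.Nonempty := ⟨0, h0F⟩
  have hcard : F.card = F.card - 1 + 1 := by
    have := hne.card_pos
    omega
  refine ⟨⟨F.card - 1, F.orderEmbOfFin hcard, (F.orderEmbOfFin hcard).strictMono, ?_, ?_⟩, ?_⟩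
  · have := F.orderEmbOfFin_zero hcard (Nat.succ_pos _)
    exact this.trans (le_antisymm (F.min'_le 0 h0F) (Fin.zero_le _))
  · have := F.orderEmbOfFin_last hcard (Nat.succ_pos _)
    exact this.trans (le_antisymm (Fin.le_last _) (F.le_max' _ hlF))
  · rw [vertices, Finset.range_orderEmbOfFin, hF, Set.coe_toFinset]

theorem ideal_mem_cmInitialIdeals (hd : 1 ≤ d) (s : BreakSeq d) :
    s.ideal K ∈ cmInitialIdeals K d := by
  refine ⟨⟨weightLexOrder (vertexWeight s.vertices), ?_⟩, ?_⟩
  · rw [s.ideal_eq_vertexIdeal, (refinesWeight_weightLexOrder _).initialIdeal_curve_eq hd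
      s.zero_mem_vertices s.last_mem_vertices]
  · rw [s.ideal_eq_vertexIdeal]
    exact s.isCohenMacaulayRing_quotient K hd

theorem exists_ideal_eq (hd : 1 ≤ d) {I : Ideal (MvPolynomial (Fin (d + 1)) K)}
    (hI : I ∈ cmInitialIdeals K d) : ∃ s : BreakSeq d, s.ideal K = I := by
  obtain ⟨⟨m, rfl⟩, hcm⟩ := hI
  obtain ⟨V, h0, hl, h⟩ := initialIdeal_curve_eq_of_isCohenMacaulayRing m hd hcm
  obtain ⟨s, rfl⟩ := exists_vertices_eq h0 hl
  exact ⟨s, by rw [h, s.ideal_eq_vertexIdeal]⟩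

theorem ideal_bijOn (hd : 1 ≤ d) :
    Set.BijOn (fun s : BreakSeq d => s.ideal K) Set.univ (cmInitialIdeals K d) := by
  refine ⟨fun s _ => s.ideal_mem_cmInitialIdeals hd, fun s _ t _ h => ?_, fun I hI => ?_⟩
  · simp only [s.ideal_eq_vertexIdeal, t.ideal_eq_vertexIdeal] at h
    exact vertices_injective (eq_of_radical_vertexIdeal_eq (congrArg Ideal.radical h))
  · obtain ⟨s, hs⟩ := exists_ideal_eq hd hI
    exact ⟨s, Set.mem_univ _, hs⟩

/-- The sequences are counted by their vertex sets, the sets of indices that contain `0` and `d`. -/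
theorem natCard (hd : 1 ≤ d) : Nat.card (BreakSeq d) = 2 ^ (d - 1) := by
  classical
  have hrange : Set.range (vertices : BreakSeq d → Set (Fin (d + 1))) =
      (fun F : Finset (Fin (d + 1)) => (F : Set (Fin (d + 1)))) ''
        (Finset.Icc {0, Fin.last d} Finset.univ : Finset (Finset (Fin (d + 1)))) := by
    ext V
    constructor
    · rintro ⟨s, rfl⟩
      refine ⟨s.vertices.toFinset, ?_, by simp⟩
      simp [Set.insert_subset_iff, s.zero_mem_vertices, s.last_mem_vertices]
    · rintro ⟨F, hF, rfl⟩
      have hsub := (Finset.mem_Icc.1 hF).1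
      exact exists_vertices_eq (hsub (by simp)) (hsub (by simp))
  rw [← Set.ncard_range_of_injective vertices_injective, hrange,
    Set.ncard_image_of_injective _ Finset.coe_injective, Set.ncard_coe_finset,
    Finset.card_Icc_finset (Finset.subset_univ _), Finset.card_univ, Fintype.card_fin,
    Finset.card_pair]
  · rfl
  · intro h
    have := congrArg Fin.val h
    simp at this
    omega

theorem ncard_cmInitialIdeals (hd : 1 ≤ d) : (cmInitialIdeals K d).ncard = 2 ^ (d - 1) := by
  rw [← (ideal_bijOn hd).image_eq, (ideal_bijOn hd).injOn.ncard_image,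
    Set.ncard_univ, natCard hd]

theorem injOn_radical_cmInitialIdeals (hd : 1 ≤ d) :
    Set.InjOn Ideal.radical (cmInitialIdeals K d) := by
  intro I hI J hJ h
  obtain ⟨s, rfl⟩ := exists_ideal_eq hd hI
  obtain ⟨t, rfl⟩ := exists_ideal_eq hd hJ
  rw [s.ideal_eq_vertexIdeal, t.ideal_eq_vertexIdeal] at h
  rw [vertices_injective (eq_of_radical_vertexIdeal_eq h)]

/-- The initial monomials of the minors are the generators of the ideal of the sequence. -/
theorem span_initialMonomial_curveMinor (s : BreakSeq d) {m : MonomialOrder (Fin (d + 1))}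
    (hm : RefinesWeight m (vertexWeight s.vertices)) :
    Ideal.span {g | ∃ c e : Fin d, c < e ∧ g = initialMonomial m (curveMinor K d c e)} =
      s.ideal K := by
  rw [ideal]
  congr 1
  ext g
  constructor
  · rintro ⟨c, e, hce, rfl⟩
    by_cases h : IsCut s.vertices c e
    · exact Or.inl ⟨c, e, hce, s.separates_iff.2 h,
        hm.initialMonomial_curveMinor_of_isCut s.zero_mem_vertices hce h⟩
    · exact Or.inr ⟨c, e, hce, s.sameBlock_iff.2 h,
        hm.initialMonomial_curveMinor_of_not_isCut s.zero_mem_vertices hce h⟩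
  · rintro (⟨c, e, hce, h, rfl⟩ | ⟨c, e, hce, h, rfl⟩)
    · exact ⟨c, e, hce, (hm.initialMonomial_curveMinor_of_isCut s.zero_mem_vertices hce
        (s.separates_iff.1 h)).symm⟩
    · exact ⟨c, e, hce, (hm.initialMonomial_curveMinor_of_not_isCut s.zero_mem_vertices hce
        (s.sameBlock_iff.1 h)).symm⟩

end BreakSeq

end Classification

theorem mainTheorem3 {K : Type*} [Field K] (d : ℕ) (hd : 1 ≤ d) :
    -- the number of Cohen-Macaulay monomial initial ideals
    (cmInitialIdeals K d).ncard = 2 ^ (d - 1) ∧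
    -- the bijection with the sequences, and with the radicals
    Set.BijOn (fun s : BreakSeq d => s.ideal K) Set.univ (cmInitialIdeals K d) ∧
    Set.InjOn Ideal.radical (cmInitialIdeals K d) ∧
    (∀ s : BreakSeq d, (s.ideal K).radical = s.radicalIdeal K) ∧
    -- realization by a weight vector, through the initial terms of the minors
    (∀ s : BreakSeq d, ∃ a : Fin (d + 1) → ℕ,
      a 0 = 0 ∧ StrictMono a ∧
      weightInitialIdeal a (rationalNormalCurveIdeal K d) = s.ideal K ∧
      (∃ m : MonomialOrder.{0, 0} (Fin (d + 1)), RefinesWeight m a) ∧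
      ∀ m : MonomialOrder.{0, 0} (Fin (d + 1)), RefinesWeight m a →
        initialIdeal m (rationalNormalCurveIdeal K d) = s.ideal K ∧
        Ideal.span {g | ∃ c e : Fin d, c < e ∧ g = initialMonomial m (curveMinor K d c e)} =
          s.ideal K ∧
        ∀ c e : Fin d, c < e →
          (s.Separates c e →
            initialMonomial m (curveMinor K d c e) = X c.castSucc * X e.succ) ∧
          (s.SameBlock c e →
            initialMonomial m (curveMinor K d c e) = X c.succ * X e.castSucc)) ∧
    -- the reduced Gröbner basis and its initial terms
    (∀ (s : BreakSeq d) (m : MonomialOrder.{0, 0} (Fin (d + 1))),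
      initialIdeal m (rationalNormalCurveIdeal K d) = s.ideal K →
        IsReducedGroebnerBasis m (rationalNormalCurveIdeal K d) (s.binomials K) ∧
        ∀ a b p q : Fin (d + 1), s.IsRule a b p q →
          initialMonomial m (X a * X b - X p * X q : MvPolynomial (Fin (d + 1)) K) =
            X a * X b) := by
  refine ⟨BreakSeq.ncard_cmInitialIdeals hd, BreakSeq.ideal_bijOn hd,
    BreakSeq.injOn_radical_cmInitialIdeals hd, fun s => s.radical_ideal hd, fun s => ?_,
    fun s m hm => ⟨s.isReducedGroebnerBasis_binomials hd hm, fun a b p q h =>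
      initialMonomial_X_mul_X_sub (BreakSeq.IsRule.toSyn_lt s hd hm h)⟩⟩
  have h0 := s.zero_mem_vertices
  have hl := s.last_mem_vertices
  refine ⟨vertexWeight s.vertices, vertexWeight_zero, vertexWeight_strictMono h0, ?_,
    ⟨weightLexOrder (vertexWeight s.vertices), refinesWeight_weightLexOrder _⟩,
    fun m hm => ⟨?_, s.span_initialMonomial_curveMinor hm,
      fun c e hce => ⟨fun h => ?_, fun h => ?_⟩⟩⟩
  · rw [weightInitialIdeal_curve_eq_vertexIdeal hd h0 hl, s.ideal_eq_vertexIdeal]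
  · rw [hm.initialIdeal_curve_eq hd h0 hl, s.ideal_eq_vertexIdeal]
  · exact hm.initialMonomial_curveMinor_of_isCut h0 hce (s.separates_iff.1 h)
  · exact hm.initialMonomial_curveMinor_of_not_isCut h0 hce (s.sameBlock_iff.1 h)
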